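/- Let $K$ be a non-archimedean local field whose residue field has characteristic $p \neq 3$, and let $K^{\mathrm{ac}}$ be an algebraic closure of $K$. Let $E$ be an elliptic curve over $K$ with additive, potentially good reduction, given by a minimal Weierstrass equation $y^2+a_1xy+a_3y=x^3+a_2x^2+a_4x+a_6$ with the usual associated quantities $b_2,b_4,b_6,b_8$ and discriminant $\Delta$. Let $L=K(E[3])\subset K^{\mathrm{ac}}$ be the field generated over $K$ by the coordinates of the $3$-torsion points of $E(K^{\mathrm{ac}})$, and let $G=\mathrm{Gal}(L/K)$. Let $\zeta_3\in K^{\mathrm{ac}}$ be a primitive third root of unity. Let $\Delta^{1/3}\in K^{\mathrm{ac}}$ be a cube root of $\Delta$, chosen in $K$ if $\Delta$ is a cube in $K$, and put $K_1=K(\Delta^{1/3})$. Let $\alpha_1,\alpha_2,\alpha_3,\alpha_4\in K^{\mathrm{ac}}$ be the roots of $g(x)=3x^4+b_2x^3+3b_4x^2+3b_6x+b_8$, numbered so that $\Delta^{1/3}=b_4-3(\alpha_1\alpha_2+\alpha_3\alpha_4)$. Put $s=\alpha_1+\alpha_2$, $t=\alpha_1\alpha_2$, $\alpha=\alpha_1$,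 and let $\beta\in K^{\mathrm{ac}}$ satisfy $\beta^2+a_1\alpha\beta+a_3\beta=\alpha^3+a_2\alpha^2+a_4\alpha+a_6$. Write $C_n$ for the cyclic group of order $n$, $D_{2n}$ for the dihedral group of order $2n$, $Q_8$ for the quaternion group of order $8$ and $\mathit{SD}_{16}$ for the semidihedral group of order $16$. (1) Suppose $\zeta_3\in K$ and $\Delta^{1/3}\in K$. (a) If $\alpha\in K$, then $G\simeq C_2$. (b) If $\alpha\notin K$ and $s,t\in K$, then $G\simeq C_4$. (c) If $K(s,t)\neq K$ and $\alpha\in K(s,t)$, then $G\simeq C_4$. (d) If $K(s,t)\neq K$ and $\alpha\notin K(s,t)$, then $G\simeq Q_8$. (2) Suppose $\zeta_3\in K$ and $\Delta^{1/3}\notin K$. (a) If $\alpha,\beta\in K_1$, then $G\simeq C_3$. (b) If $\alpha\in K_1$ and $\beta\notin K_1$, then $G\simeq C_6$. (c) If $K_1(s,t)\neq K_1$, then $G\simeq \mathrm{SL}_2(\mathbb{F}_3)$. (3) Suppose $\zeta_3\notin K$ and $\Delta^{1/3}\in K$. (a) If $\alpha\in K(\zeta_3)$, then $G\simeq C_2\times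 C_2$. (b) If $\alpha\notin K(\zeta_3)$, $s,t\in K(\zeta_3)$ and $K(s,t)\neq K$, then $G\simeq C_8$. (c) If $\alpha\notin K(\zeta_3)$ and $s,t\in K$, then $G\simeq D_8$. (d) If $K(\zeta_3,s,t)\neq K(\zeta_3)$ and $\alpha\in K(\zeta_3,s,t)$, then $G\simeq D_8$. (e) If $K(\zeta_3,s,t)\neq K(\zeta_3)$, then $\alpha\notin K(\zeta_3)$ and $G\simeq \mathit{SD}_{16}$. (Taken together, (d) and (e) say that the hypotheses of (d) never hold.) (4) Suppose $\zeta_3\notin K$ and $\Delta^{1/3}\notin K$. (a) If $\alpha,\beta\in K_1(\zeta_3)$, then $G\simeq D_6$. (b) If $\alpha\in K_1(\zeta_3)$ and $\beta\notin K_1(\zeta_3)$, then $G\simeq D_{12}$. (c) If $K_1(\zeta_3,s,t)\neq K_1(\zeta_3)$, then $\alpha\notin K_1(\zeta_3)$ and $G\simeq \mathrm{GL}_2(\mathbb{F}_3)$. -/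

import Mathlib

open scoped ValuativeRel IntermediateField

/-- The semidihedral group of order `16`,
`⟨ρ, σ | ρ ^ 8 = σ ^ 2 = 1, σ * ρ * σ = ρ ^ 3⟩`.
Its elements are written uniquely as `r i = ρ ^ i` and `sr i = σ * ρ ^ i` with `i` modulo `8`. -/
inductive SemidihedralGroup16 : Type
  | r : ZMod 8 → SemidihedralGroup16
  | sr : ZMod 8 → SemidihedralGroup16
  deriving DecidableEq

namespace SemidihedralGroup16

/-- The multiplication obtained from `ρ ^ i * σ = σ * ρ ^ (3 * i)` and `σ ^ 2 = 1`. -/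
def mul : SemidihedralGroup16 → SemidihedralGroup16 → SemidihedralGroup16
  | r i, r j => r (i + j)
  | r i, sr j => sr (3 * i + j)
  | sr i, r j => sr (i + j)
  | sr i, sr j => r (3 * i + j)

/-- The inverse: `(σ * ρ ^ i)⁻¹ = ρ ^ (-i) * σ = σ * ρ ^ (-3 * i)`. -/
def inv : SemidihedralGroup16 → SemidihedralGroup16
  | r i => r (-i)
  | sr i => sr (-(3 * i))

instance : Group SemidihedralGroup16 where
  mul := mul
  one := r 0
  inv := inv
  mul_assoc := by
    rintro (i | i) (j | j) (k | k) <;>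
      simp only [HMul.hMul, mul] <;>
      congr 1 <;> revert i j k <;> decide
  one_mul := by
    rintro (i | i) <;> simp only [HMul.hMul, mul] <;> congr 1 <;> revert i <;> decide
  mul_one := by
    rintro (i | i) <;> simp only [HMul.hMul, mul] <;> congr 1 <;> revert i <;> decide
  inv_mul_cancel := by
    rintro (i | i) <;> revert i <;> decide

end SemidihedralGroup16

namespace WeierstrassCurve

universe u v

/-- `W` has potentially good reduction: over some finite extension `F` of the local field `K`, the
curve acquires good reduction, i.e. it has a minimal Weierstrass equation over `F` whose
discriminant is a unit. -/
def HasPotentiallyGoodReduction {K : Type u} [Field K] [ValuativeRel K] (W : WeierstrassCurve K) :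
    Prop :=
  ∃ (F : Type u) (_ : Field F) (_ : ValuativeRel F) (_ : TopologicalSpace F)
    (_ : IsNonarchimedeanLocalField F) (_ : Algebra K F) (_ : ValuativeExtension K F)
    (_ : FiniteDimensional K F) (C : VariableChange F),
    (C • W.baseChange F).HasGoodReduction 𝒪[F]

open Classical in
/-- The field `K(E[m])` inside `Ω`: generated over `K` by the `x` and `y` coordinates of the
(affine) points of `E(Ω)` killed by `m`. -/
noncomputable def torsionField {K : Type u} [Field K] (W : WeierstrassCurve K) (Ω : Type v)
    [Field Ω] [Algebra K Ω] (m : ℕ) : IntermediateField K Ω :=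
  IntermediateField.adjoin K
    {c : Ω | ∃ (x y : Ω) (h : (W.baseChange Ω).toAffine.Nonsingular x y),
      m • Affine.Point.some x y h = 0 ∧ (c = x ∨ c = y)}

/-- The Galois group of `K(E[m])` over `K`. -/
abbrev TorsionGal {K : Type u} [Field K] (W : WeierstrassCurve K) (Ω : Type v)
    [Field Ω] [Algebra K Ω] (m : ℕ) : Type v :=
  W.torsionField Ω m ≃ₐ[K] W.torsionField Ω m

end WeierstrassCurve

/-! Choose a basis `P, Q` of `E[3]` such that `P, Q, P + Q, P - Q` have abscissae `α₁, α₂, α₃, α₄`;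
replacing `Q` by `-Q` exchanges the last two, so the numbering can always be met, and `P` may be
taken to be `(α, β)`. The Galois action becomes a homomorphism `ρ` to `GL₂(𝔽₃)` whose kernel is the
subgroup fixing `K(E[3])`, so `G` is the image `H` of `ρ`. The four roots correspond to the four
lines of `𝔽₃²`.

This gives a dictionary, stored in `ThreeTorsionData`. An automorphism `g` fixes `α` when `ρ g`
preserves the first axis, `α` and `β` when `ρ g` fixes the first basis vector, `s` and `t` when `ρ
g` permutes the two axes (`Monomial`), `Δ^{1/3}` when it preserves the partition of the lines into
axes and diagonals (`Paired`), and `ζ₃` when its determinant is `1`. The last two entries come from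
the resolvent cubic: the values `b₄ - 3(αᵢαⱼ + αₖαₗ)` at the three partitions are `δ, ωδ, ω²δ`
(`exists_cubicResolvent_eq`), and matrices of determinant `1` permute the partitions cyclically
whereas the others reverse the cyclic order. Since `K` may be imperfect, separability of all these
elements is proved before descending from fixed elements to subfields
(`mem_adjoin_iff_forall_fixed`).

Each case is then a statement about subgroups `H` of `GL₂(𝔽₃)`, decided by whether `H` lies in
`SL₂(𝔽₃)`, whether it lies in the Sylow subgroup of paired matrices, and how it meets the quaternion
group `Quat`.

Two facts about `K` are still needed. If `Δ` is a cube, no nonzero `3`-torsion point is rational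
(`HasAdditiveReduction.not_isCube_Δ`): a curve with such a point has the form `y² + pxy + qy = x³`
with `Δ = q³(p³ - 27q)`; additive reduction makes `p` and `q` nonunits, a cube `Δ` forces `π³ ∣ q`,
and the equation is not minimal. This excludes the groups that are too small. If `Δ` is not a cube
in `K`, it is not a cube in `K(ζ₃)` either (`exists_pow_three_eq_forall_fixed`), so `H` contains an
element of determinant `1` that is not paired. -/

/-! ### Recognising small groups inside a given group -/

section Recognition

variable {M : Type*} [Group M]

/-- A subgroup consisting of the powers of an element of order `n` is cyclic of order `n`. -/
theorem Subgroup.nonempty_mulEquiv_zmod {H : Subgroup M} {g : M} {n : ℕ} (hg : g ∈ H)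
    (hn : orderOf g = n) (hgen : ∀ x ∈ H, ∃ k : ℕ, x = g ^ k) :
    Nonempty (H ≃* Multiplicative (ZMod n)) := by
  have hH : H = Subgroup.zpowers g := by
    refine le_antisymm (fun x hx => ?_) (by simpa using hg)
    obtain ⟨k, rfl⟩ := hgen x hx
    exact Subgroup.npow_mem_zpowers g k
  subst hH
  exact ⟨mulEquivOfCyclicCardEq (by rw [Nat.card_zpowers, hn]; exact (Nat.card_zmod n).symm)⟩

/-- An injective homomorphism with range `H` identifies its source with `H`. -/
theorem Subgroup.nonempty_mulEquiv_of_range_eq {X : Type*} [Group X] {H : Subgroup M} (f : X →* M)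
    (hf : Function.Injective f) (hH : f.range = H) : Nonempty (H ≃* X) :=
  hH ▸ ⟨(MonoidHom.ofInjective hf).symm⟩

theorem pow_val_add {a : M} {n : ℕ} [NeZero n] (ha : a ^ n = 1) (i j : ZMod n) :
    a ^ (i + j).val = a ^ i.val * a ^ j.val := by
  rw [ZMod.val_add, ← pow_add, ← pow_eq_pow_mod _ ha]

theorem pow_val_neg {a : M} {n : ℕ} [NeZero n] (ha : a ^ n = 1) (i : ZMod n) :
    a ^ (-i).val = (a ^ i.val)⁻¹ := by
  rw [eq_inv_iff_mul_eq_one, ← pow_val_add ha]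
  simp

theorem pow_val_injective {a : M} {n : ℕ} [NeZero n] (ha : orderOf a = n) :
    Function.Injective fun i : ZMod n => a ^ i.val := by
  subst ha
  intro i j h
  exact ZMod.val_injective _
    (pow_injOn_Iio_orderOf (Set.mem_Iio.2 i.val_lt) (Set.mem_Iio.2 j.val_lt) h)

theorem pow_val_natCast {a : M} {n : ℕ} (ha : a ^ n = 1) (k : ℕ) :
    a ^ (k : ZMod n).val = a ^ k := by
  rw [ZMod.val_natCast, ← pow_eq_pow_mod _ ha]

/-- A subgroup generated by an element of order `n` and an involution inverting it is dihedral. -/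
theorem Subgroup.nonempty_mulEquiv_dihedralGroup {H : Subgroup M} {a b : M} {n : ℕ} [NeZero n]
    (ha : a ∈ H) (hb : b ∈ H) (hn : orderOf a = n) (hbb : b * b = 1) (hba : b * a * (b * a) = 1)
    (hb' : ∀ k : ℕ, b ≠ a ^ k) (hgen : ∀ x ∈ H, ∃ k : ℕ, x = a ^ k ∨ x = b * a ^ k) :
    Nonempty (H ≃* DihedralGroup n) := by
  have han : a ^ n = 1 := hn ▸ pow_orderOf_eq_one a
  have hab : SemiconjBy b a⁻¹ a := by
    have hbi : b⁻¹ = b := inv_eq_of_mul_eq_one_left hbb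
    rw [SemiconjBy, mul_inv_eq_iff_eq_mul]
    exact hbi.symm.trans (inv_eq_of_mul_eq_one_right (by simpa only [mul_assoc] using hba))
  have hcomm (i : ZMod n) : a ^ i.val * b = b * a ^ (-i).val := by
    rw [pow_val_neg han, ← inv_pow]
    exact (hab.pow_right i.val).eq.symm
  let f : DihedralGroup n →* M := MonoidHom.mk' (fun
      | .r i => a ^ i.val
      | .sr i => b * a ^ i.val) (by
    rintro (i | i) (j | j)
    · simp [pow_val_add han]
    · simp only [DihedralGroup.r_mul_sr]
      rw [← mul_assoc, hcomm, mul_assoc, ← pow_val_add han, neg_add_eq_sub]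
    · simp [pow_val_add han, mul_assoc]
    · simp only [DihedralGroup.sr_mul_sr]
      rw [mul_assoc, ← mul_assoc _ b, hcomm, mul_assoc, ← mul_assoc, hbb, one_mul,
        ← pow_val_add han, neg_add_eq_sub])
  have hne (i j : ZMod n) : b * a ^ i.val ≠ a ^ j.val := fun h => by
    rw [← eq_mul_inv_iff_mul_eq, ← pow_val_neg han, ← pow_val_add han] at h
    exact hb' _ h
  refine nonempty_mulEquiv_of_range_eq f ?_ (le_antisymm ?_ fun x hx => ?_)
  · rintro (i | i) (j | j) h
    · exact congrArg _ (pow_val_injective hn h)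
    · exact absurd h.symm (hne _ _)
    · exact absurd h (hne _ _)
    · exact congrArg _ (pow_val_injective hn (mul_left_cancel h))
  · rintro _ ⟨i | i, rfl⟩
    · exact pow_mem ha _
    · exact mul_mem hb (pow_mem ha _)
  · obtain ⟨k, rfl | rfl⟩ := hgen x hx
    · exact ⟨.r k, pow_val_natCast han k⟩
    · exact ⟨.sr k, congrArg (b * ·) (pow_val_natCast han k)⟩

/-- A subgroup generated by an element `a` of order `4` and an element with square `a ^ 2`
inverting `a` is a quaternion group. -/
theorem Subgroup.nonempty_mulEquiv_quaternionGroup {H : Subgroup M} {a b : M}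
    (ha : a ∈ H) (hb : b ∈ H) (hn : orderOf a = 4) (hbb : b * b = a * a) (hab : a * b * a = b)
    (hb' : ∀ k : ℕ, b ≠ a ^ k) (hgen : ∀ x ∈ H, ∃ k : ℕ, x = a ^ k ∨ x = b * a ^ k) :
    Nonempty (H ≃* QuaternionGroup 2) := by
  have han : a ^ 4 = 1 := hn ▸ pow_orderOf_eq_one a
  have hab : SemiconjBy b a⁻¹ a := by
    rw [SemiconjBy, mul_inv_eq_iff_eq_mul, hab]
  have hcomm (i : ZMod 4) : a ^ i.val * b = b * a ^ (-i).val := by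
    rw [pow_val_neg han, ← inv_pow]
    exact (hab.pow_right i.val).eq.symm
  let f : QuaternionGroup 2 →* M := MonoidHom.mk' (fun
      | .a i => a ^ ZMod.val (n := 4) i
      | .xa i => b * a ^ ZMod.val (n := 4) i) (by
    rintro (i | i) (j | j)
    · exact pow_val_add han i j
    · simp only [QuaternionGroup.a_mul_xa]
      rw [← mul_assoc, hcomm, mul_assoc, ← pow_val_add han, neg_add_eq_sub]
    · simp only [QuaternionGroup.xa_mul_a]
      rw [mul_assoc, ← pow_val_add han]
    · simp only [QuaternionGroup.xa_mul_xa]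
      have h2 : a * a = a ^ (2 : ZMod 4).val := (pow_two a).symm
      rw [mul_assoc, ← mul_assoc _ b, hcomm, mul_assoc, ← mul_assoc, hbb, h2,
        ← pow_val_add han, ← pow_val_add han, neg_add_eq_sub, ← add_sub_assoc]
      rfl)
  have hne (i j : ZMod 4) : b * a ^ i.val ≠ a ^ j.val := fun h => by
    rw [← eq_mul_inv_iff_mul_eq, ← pow_val_neg han, ← pow_val_add han] at h
    exact hb' _ h
  refine nonempty_mulEquiv_of_range_eq f ?_ (le_antisymm ?_ fun x hx => ?_)
  · rintro (i | i) (j | j) h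
    · exact congrArg _ (pow_val_injective hn h)
    · exact absurd h.symm (hne _ _)
    · exact absurd h (hne _ _)
    · exact congrArg _ (pow_val_injective hn (mul_left_cancel h))
  · rintro _ ⟨i | i, rfl⟩
    · exact pow_mem ha _
    · exact mul_mem hb (pow_mem ha _)
  · obtain ⟨k, rfl | rfl⟩ := hgen x hx
    · exact ⟨.a k, pow_val_natCast han k⟩
    · exact ⟨.xa k, congrArg (b * ·) (pow_val_natCast han k)⟩

/-- A subgroup generated by an element `a` of order `8` and an involution conjugating `a` to
`a ^ 3` is semidihedral. -/
theorem Subgroup.nonempty_mulEquiv_semidihedralGroup16 {H : Subgroup M} {a b : M}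
    (ha : a ∈ H) (hb : b ∈ H) (hn : orderOf a = 8) (hbb : b * b = 1) (hab : a * b = b * a ^ 3)
    (hb' : ∀ k : ℕ, b ≠ a ^ k) (hgen : ∀ x ∈ H, ∃ k : ℕ, x = a ^ k ∨ x = b * a ^ k) :
    Nonempty (H ≃* SemidihedralGroup16) := by
  have han : a ^ 8 = 1 := hn ▸ pow_orderOf_eq_one a
  have hcomm (i : ZMod 8) : a ^ i.val * b = b * a ^ (3 * i).val := by
    have h3 : a ^ (3 * i).val = (a ^ 3) ^ i.val := by
      rw [← pow_mul, ← pow_val_natCast han (3 * i.val)]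
      simp
    rw [h3]
    exact ((SemiconjBy.pow_right (hab.symm : SemiconjBy b (a ^ 3) a)) i.val).eq.symm
  let f : SemidihedralGroup16 →* M := MonoidHom.mk' (fun
      | .r i => a ^ i.val
      | .sr i => b * a ^ i.val) (by
    rintro (i | i) (j | j)
    · exact pow_val_add han i j
    · change b * a ^ (3 * i + j).val = a ^ i.val * (b * a ^ j.val)
      rw [← mul_assoc, hcomm, mul_assoc, ← pow_val_add han]
    · change b * a ^ (i + j).val = b * a ^ i.val * a ^ j.val
      rw [mul_assoc, ← pow_val_add han]
    · change a ^ (3 * i + j).val = b * a ^ i.val * (b * a ^ j.val)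
      rw [mul_assoc, ← mul_assoc _ b, hcomm, mul_assoc, ← mul_assoc, hbb, one_mul,
        ← pow_val_add han])
  have hne (i j : ZMod 8) : b * a ^ i.val ≠ a ^ j.val := fun h => by
    rw [← eq_mul_inv_iff_mul_eq, ← pow_val_neg han, ← pow_val_add han] at h
    exact hb' _ h
  refine nonempty_mulEquiv_of_range_eq f ?_ (le_antisymm ?_ fun x hx => ?_)
  · rintro (i | i) (j | j) h
    · exact congrArg _ (pow_val_injective hn h)
    · exact absurd h.symm (hne _ _)
    · exact absurd h (hne _ _)
    · exact congrArg _ (pow_val_injective hn (mul_left_cancel h))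
  · rintro _ ⟨i | i, rfl⟩
    · exact pow_mem ha _
    · exact mul_mem hb (pow_mem ha _)
  · obtain ⟨k, rfl | rfl⟩ := hgen x hx
    · exact ⟨.r k, pow_val_natCast han k⟩
    · exact ⟨.sr k, congrArg (b * ·) (pow_val_natCast han k)⟩

end Recognition

/-! ### Subgroups of `GL₂(𝔽₃)` -/

set_option linter.unusedSimpArgs false
set_option synthInstance.maxSize 2000
set_option synthInstance.maxHeartbeats 400000

namespace GLTwoThree

open Matrix

/-- The matrix `g` permutes the two coordinate axes. -/
def Monomial (g : GL (Fin 2) (ZMod 3)) : Prop :=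
  (g 0 1 = 0 ∧ g 1 0 = 0) ∨ (g 0 0 = 0 ∧ g 1 1 = 0)

/-- The matrix `g` preserves the partition of the four lines of `𝔽₃²` into the two coordinate axes
and the two diagonals. -/
def Paired (g : GL (Fin 2) (ZMod 3)) : Prop :=
  Monomial g ∨ (g 0 0 ≠ 0 ∧ g 0 1 ≠ 0 ∧ g 1 0 ≠ 0 ∧ g 1 1 ≠ 0)

/-- The matrix `g` lies in the Sylow `2`-subgroup of `SL₂(𝔽₃)`, a quaternion group. -/
def Quat (g : GL (Fin 2) (ZMod 3)) : Prop :=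
  g.1.det = 1 ∧ Paired g

theorem det_eq_one_or (g : GL (Fin 2) (ZMod 3)) :
    g.1.det = 1 ∨
      g.1.det = -1 := by
  have h : g.1.det ≠ 0 := g.det_ne_zero
  revert h
  generalize g.1.det = d
  revert d
  decide

theorem Quat.eq_one_or {x : GL (Fin 2) (ZMod 3)} (hx : Quat x) (h : x 1 0 = 0) :
    x = 1 ∨ x = -1 := by
  simp only [Quat, Paired, Monomial, Commute, SemiconjBy, GeneralLinearGroup.ext_iff, ne_eq,
    Fin.forall_fin_two, det_fin_two, Units.val_neg, Units.val_one, one_apply, mul_apply,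
    GeneralLinearGroup.coe_mul, Matrix.neg_apply, Fin.sum_univ_two] at *
  revert hx h
  -- With the four entries treated as free variables, the claim is a finite check over `𝔽₃`. The
  -- other matrix facts of this part are settled in the same way.
  generalize x 0 0 = a, x 0 1 = b, x 1 0 = c, x 1 1 = d
  revert a b c d
  decide

theorem Paired.mul {x y : GL (Fin 2) (ZMod 3)} (hx : Paired x) (hy : Paired y) :
    Paired (x * y) := by
  have hx' := x.det_ne_zero
  have hy' := y.det_ne_zero
  simp only [Quat, Paired, Monomial, Commute, SemiconjBy, GeneralLinearGroup.ext_iff, ne_eq,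
    Fin.forall_fin_two, det_fin_two, Units.val_neg, Units.val_one, one_apply, mul_apply,
    GeneralLinearGroup.coe_mul, Matrix.neg_apply, Fin.sum_univ_two] at *
  revert hy' hy
  generalize y 0 0 = e, y 0 1 = f, y 1 0 = g, y 1 1 = h
  revert e f g h
  revert hx' hx
  generalize x 0 0 = a, x 0 1 = b, x 1 0 = c, x 1 1 = d
  revert a b c d
  decide

theorem Monomial.paired {x : GL (Fin 2) (ZMod 3)} (hx : Monomial x) : Paired x :=
  Or.inl hx

theorem Quat.mul_self {x : GL (Fin 2) (ZMod 3)} (hx : Quat x) (h : x 1 0 ≠ 0) :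
    x * x = -1 := by
  simp only [Quat, Paired, Monomial, Commute, SemiconjBy, GeneralLinearGroup.ext_iff, ne_eq,
    Fin.forall_fin_two, det_fin_two, Units.val_neg, Units.val_one, one_apply, mul_apply,
    GeneralLinearGroup.coe_mul, Matrix.neg_apply, Fin.sum_univ_two] at *
  revert hx h
  generalize x 0 0 = a, x 0 1 = b, x 1 0 = c, x 1 1 = d
  revert a b c d
  decide

theorem Quat.mul_self_of_not_monomial {x : GL (Fin 2) (ZMod 3)} (hx : Quat x) (h : ¬ Monomial x) :
    x * x = -1 := by
  simp only [Quat, Paired, Monomial, Commute, SemiconjBy, GeneralLinearGroup.ext_iff, ne_eq,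
    Fin.forall_fin_two, det_fin_two, Units.val_neg, Units.val_one, one_apply, mul_apply,
    GeneralLinearGroup.coe_mul, Matrix.neg_apply, Fin.sum_univ_two] at *
  revert hx h
  generalize x 0 0 = a, x 0 1 = b, x 1 0 = c, x 1 1 = d
  revert a b c d
  decide

/-- The monomial elements of the quaternion group form a cyclic subgroup of order four, generated by
either of its antidiagonal elements. -/
theorem Quat.monomial_cases {x y : GL (Fin 2) (ZMod 3)} (hx : Quat x) (hxm : Monomial x)
    (h : x 1 0 ≠ 0)
    (hy : Quat y) (hym : Monomial y) :
    (y = 1 ∨ y = -1) ∨ y = x ∨ y = -x := by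
  simp only [Quat, Paired, Monomial, Commute, SemiconjBy, GeneralLinearGroup.ext_iff, ne_eq,
    Fin.forall_fin_two, det_fin_two, Units.val_neg, Units.val_one, one_apply, mul_apply,
    GeneralLinearGroup.coe_mul, Matrix.neg_apply, Fin.sum_univ_two] at *
  revert hy hym
  generalize y 0 0 = e, y 0 1 = f, y 1 0 = g, y 1 1 = h
  revert e f g h
  revert hx hxm h
  generalize x 0 0 = a, x 0 1 = b, x 1 0 = c, x 1 1 = d
  revert a b c d
  decide

/-- Writing the group as `±1, ±i, ±j, ±k` with `±i` antidiagonal, the non-monomial elements are `±j,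
±k`, and a product of one of `±j` with one of `±k` is `±i`. -/
theorem Quat.not_monomial_cases {x y : GL (Fin 2) (ZMod 3)} (hx : Quat x) (hxm : ¬ Monomial x)
    (hy : Quat y) (hym : ¬ Monomial y) :
    (y = x ∨ y = -x) ∨ Monomial (x * y) ∧ (x * y) 1 0 ≠ 0 := by
  simp only [Quat, Paired, Monomial, Commute, SemiconjBy, GeneralLinearGroup.ext_iff, ne_eq,
    Fin.forall_fin_two, det_fin_two, Units.val_neg, Units.val_one, one_apply, mul_apply,
    GeneralLinearGroup.coe_mul, Matrix.neg_apply, Fin.sum_univ_two] at *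
  revert hy hym
  generalize y 0 0 = e, y 0 1 = f, y 1 0 = g, y 1 1 = h
  revert e f g h
  revert hx hxm
  generalize x 0 0 = a, x 0 1 = b, x 1 0 = c, x 1 1 = d
  revert a b c d
  decide

theorem Quat.not_commute {x y : GL (Fin 2) (ZMod 3)} (hx : Quat x) (hxm : ¬ Monomial x)
    (hy : Quat y) (hym : Monomial y) (h : y 1 0 ≠ 0) :
    ¬ Commute x y := by
  simp only [Quat, Paired, Monomial, Commute, SemiconjBy, GeneralLinearGroup.ext_iff, ne_eq,
    Fin.forall_fin_two, det_fin_two, Units.val_neg, Units.val_one, one_apply, mul_apply,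
    GeneralLinearGroup.coe_mul, Matrix.neg_apply, Fin.sum_univ_two] at *
  revert hy hym h
  generalize y 0 0 = e, y 0 1 = f, y 1 0 = g, y 1 1 = h
  revert e f g h
  revert hx hxm
  generalize x 0 0 = a, x 0 1 = b, x 1 0 = c, x 1 1 = d
  revert a b c d
  decide

theorem Quat.mul_self_of_not_commute {x y : GL (Fin 2) (ZMod 3)} (hx : Quat x) (hy : Quat y)
    (h : ¬ Commute x y) :
    x * x = -1 ∧ y * y = -1 ∧ x * y * x = y := by
  simp only [Quat, Paired, Monomial, Commute, SemiconjBy, GeneralLinearGroup.ext_iff, ne_eq,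
    Fin.forall_fin_two, det_fin_two, Units.val_neg, Units.val_one, one_apply, mul_apply,
    GeneralLinearGroup.coe_mul, Matrix.neg_apply, Fin.sum_univ_two] at *
  revert hy h
  generalize y 0 0 = e, y 0 1 = f, y 1 0 = g, y 1 1 = h
  revert e f g h
  revert hx
  generalize x 0 0 = a, x 0 1 = b, x 1 0 = c, x 1 1 = d
  revert a b c d
  decide

theorem Quat.cases_of_not_commute {x y z : GL (Fin 2) (ZMod 3)} (hx : Quat x) (hy : Quat y)
    (h : ¬ Commute x y)
    (hz : Quat z) :
    ((z = 1 ∨ z = -1) ∨ z = x ∨ z = -x) ∨ (z = y ∨ z = -y) ∨ z = y * x ∨ z = -(y * x) := by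
  simp only [Quat, Paired, Monomial, Commute, SemiconjBy, GeneralLinearGroup.ext_iff, ne_eq,
    Fin.forall_fin_two, det_fin_two, Units.val_neg, Units.val_one, one_apply, mul_apply,
    GeneralLinearGroup.coe_mul, Matrix.neg_apply, Fin.sum_univ_two] at *
  revert hz
  generalize z 0 0 = i, z 0 1 = j, z 1 0 = k, z 1 1 = l
  revert i j k l
  revert hy h
  generalize y 0 0 = e, y 0 1 = f, y 1 0 = g, y 1 1 = h
  revert e f g h
  revert hx
  generalize x 0 0 = a, x 0 1 = b, x 1 0 = c, x 1 1 = d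
  revert a b c d
  decide

/-- The quaternion group is normal of index three in `SL₂(𝔽₃)`, and `x` generates the quotient. -/
theorem paired_coset {x y : GL (Fin 2) (ZMod 3)} (hx : x.1.det = 1) (hxp : ¬ Paired x)
    (hy : y.1.det = 1) :
    Paired y ∨ Paired (y * x) ∨ Paired (y * x * x) := by
  simp only [Quat, Paired, Monomial, Commute, SemiconjBy, GeneralLinearGroup.ext_iff, ne_eq,
    Fin.forall_fin_two, det_fin_two, Units.val_neg, Units.val_one, one_apply, mul_apply,
    GeneralLinearGroup.coe_mul, Matrix.neg_apply, Fin.sum_univ_two] at *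
  revert hy
  generalize y 0 0 = e, y 0 1 = f, y 1 0 = g, y 1 1 = h
  revert e f g h
  revert hx hxp
  generalize x 0 0 = a, x 0 1 = b, x 1 0 = c, x 1 1 = d
  revert a b c d
  decide

theorem pow_three_of_not_paired {x : GL (Fin 2) (ZMod 3)} (hx : x.1.det = 1) (hxp : ¬ Paired x) :
    x * x * x = 1 ∨ x * x * x = -1 := by
  simp only [Quat, Paired, Monomial, Commute, SemiconjBy, GeneralLinearGroup.ext_iff, ne_eq,
    Fin.forall_fin_two, det_fin_two, Units.val_neg, Units.val_one, one_apply, mul_apply,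
    GeneralLinearGroup.coe_mul, Matrix.neg_apply, Fin.sum_univ_two] at *
  revert hx hxp
  generalize x 0 0 = a, x 0 1 = b, x 1 0 = c, x 1 1 = d
  revert a b c d
  decide

/-- A matrix of determinant `-1` acts as a transposition on the three partitions of the lines into
pairs, so its square acts trivially on them. -/
theorem mul_self_paired {x : GL (Fin 2) (ZMod 3)} (hx : x.1.det = -1) :
    Paired (x * x) := by
  simp only [Quat, Paired, Monomial, Commute, SemiconjBy, GeneralLinearGroup.ext_iff, ne_eq,
    Fin.forall_fin_two, det_fin_two, Units.val_neg, Units.val_one, one_apply, mul_apply,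
    GeneralLinearGroup.coe_mul, Matrix.neg_apply, Fin.sum_univ_two] at *
  revert hx
  generalize x 0 0 = a, x 0 1 = b, x 1 0 = c, x 1 1 = d
  revert a b c d
  decide

/-- Because `x ^ 3 = ±1`, the factor `x * x` is `x⁻¹` up to sign. Conjugation by `x` permutes
cyclically the three subgroups of order four of the quaternion group, so it moves `y` to one that
does not commute with it. -/
theorem quat_conj {x y : GL (Fin 2) (ZMod 3)} (hx : x.1.det = 1) (hxp : ¬ Paired x)
    (hy : Quat y) (hym : ¬ Monomial y) :
    Quat (x * y * (x * x)) ∧ ¬ Commute y (x * y * (x * x)) := by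
  simp only [Quat, Paired, Monomial, Commute, SemiconjBy, GeneralLinearGroup.ext_iff, ne_eq,
    Fin.forall_fin_two, det_fin_two, Units.val_neg, Units.val_one, one_apply, mul_apply,
    GeneralLinearGroup.coe_mul, Matrix.neg_apply, Fin.sum_univ_two] at *
  revert hy hym
  generalize y 0 0 = e, y 0 1 = f, y 1 0 = g, y 1 1 = h
  revert e f g h
  revert hx hxp
  generalize x 0 0 = a, x 0 1 = b, x 1 0 = c, x 1 1 = d
  revert a b c d
  decide

/-- If `x` is monomial it is an involution and conjugation by it exchanges the two non-monomial
subgroups of order four. Otherwise `x * x` is antidiagonal and does not commute with `y`. -/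
theorem quat_conj_of_det_eq_neg_one {x y : GL (Fin 2) (ZMod 3)} (hx : x.1.det = -1) (hxp : Paired x)
    (hy : Quat y) (hym : ¬ Monomial y) :
    ¬ Commute y (x * y * x) ∨ ¬ Commute y (x * x) := by
  simp only [Quat, Paired, Monomial, Commute, SemiconjBy, GeneralLinearGroup.ext_iff, ne_eq,
    Fin.forall_fin_two, det_fin_two, Units.val_neg, Units.val_one, one_apply, mul_apply,
    GeneralLinearGroup.coe_mul, Matrix.neg_apply, Fin.sum_univ_two] at *
  revert hy hym
  generalize y 0 0 = e, y 0 1 = f, y 1 0 = g, y 1 1 = h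
  revert e f g h
  revert hx hxp
  generalize x 0 0 = a, x 0 1 = b, x 1 0 = c, x 1 1 = d
  revert a b c d
  decide

/-- A square root of `-1` has characteristic polynomial `X² + 1`, hence determinant `1`. -/
theorem mul_self_eq_one_of_det_eq_neg_one {x : GL (Fin 2) (ZMod 3)} (hx : x.1.det = -1)
    (h : x * x = 1 ∨ x * x = -1) :
    x * x = 1 := by
  simp only [Quat, Paired, Monomial, Commute, SemiconjBy, GeneralLinearGroup.ext_iff, ne_eq,
    Fin.forall_fin_two, det_fin_two, Units.val_neg, Units.val_one, one_apply, mul_apply,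
    GeneralLinearGroup.coe_mul, Matrix.neg_apply, Fin.sum_univ_two] at *
  revert hx h
  generalize x 0 0 = a, x 0 1 = b, x 1 0 = c, x 1 1 = d
  revert a b c d
  decide

theorem mul_self_of_not_monomial {x : GL (Fin 2) (ZMod 3)} (hx : x.1.det = -1) (hxp : Paired x)
    (h : ¬ Monomial x) :
    Monomial (x * x) ∧ (x * x) 1 0 ≠ 0 := by
  simp only [Quat, Paired, Monomial, Commute, SemiconjBy, GeneralLinearGroup.ext_iff, ne_eq,
    Fin.forall_fin_two, det_fin_two, Units.val_neg, Units.val_one, one_apply, mul_apply,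
    GeneralLinearGroup.coe_mul, Matrix.neg_apply, Fin.sum_univ_two] at *
  revert hx hxp h
  generalize x 0 0 = a, x 0 1 = b, x 1 0 = c, x 1 1 = d
  revert a b c d
  decide

theorem Monomial.mul_self {x : GL (Fin 2) (ZMod 3)} (hx : x.1.det = -1) (hxm : Monomial x) :
    x * x = 1 := by
  simp only [Quat, Paired, Monomial, Commute, SemiconjBy, GeneralLinearGroup.ext_iff, ne_eq,
    Fin.forall_fin_two, det_fin_two, Units.val_neg, Units.val_one, one_apply, mul_apply,
    GeneralLinearGroup.coe_mul, Matrix.neg_apply, Fin.sum_univ_two] at *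
  revert hx hxm
  generalize x 0 0 = a, x 0 1 = b, x 1 0 = c, x 1 1 = d
  revert a b c d
  decide

theorem Paired.mul_monomial {x y : GL (Fin 2) (ZMod 3)} (hx : Paired x) (hy : Paired y)
    (hxm : ¬ Monomial x) (hym : ¬ Monomial y) : Monomial (x * y) := by
  have hx' := x.det_ne_zero
  have hy' := y.det_ne_zero
  simp only [Quat, Paired, Monomial, Commute, SemiconjBy, GeneralLinearGroup.ext_iff, ne_eq,
    Fin.forall_fin_two, det_fin_two, Units.val_neg, Units.val_one, one_apply, mul_apply,
    GeneralLinearGroup.coe_mul, Matrix.neg_apply, Fin.sum_univ_two] at *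
  revert hy' hy hym
  generalize y 0 0 = e, y 0 1 = f, y 1 0 = g, y 1 1 = h
  revert e f g h
  revert hx' hx hxm
  generalize x 0 0 = a, x 0 1 = b, x 1 0 = c, x 1 1 = d
  revert a b c d
  decide

theorem Monomial.mul_iff {x y : GL (Fin 2) (ZMod 3)} (hx : Monomial x) :
    Monomial (x * y) ↔ Monomial y := by
  have hx' := x.det_ne_zero
  simp only [Quat, Paired, Monomial, Commute, SemiconjBy, GeneralLinearGroup.ext_iff, ne_eq,
    Fin.forall_fin_two, det_fin_two, Units.val_neg, Units.val_one, one_apply, mul_apply,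
    GeneralLinearGroup.coe_mul, Matrix.neg_apply, Fin.sum_univ_two] at *
  generalize y 0 0 = e, y 0 1 = f, y 1 0 = g, y 1 1 = h
  revert e f g h
  revert hx' hx
  generalize x 0 0 = a, x 0 1 = b, x 1 0 = c, x 1 1 = d
  revert a b c d
  decide

/-- An involution of determinant `-1` has eigenvalues `1` and `-1`. -/
theorem exists_mulVec_eq_self {x : GL (Fin 2) (ZMod 3)} (hx : x.1.det = -1) (h : x * x = 1) :
    ∃ v : Fin 2 → ZMod 3, v ≠ 0 ∧ x.1 *ᵥ v = v := by
  suffices h : ∃ v w : ZMod 3, (v ≠ 0 ∨ w ≠ 0) ∧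
      x 0 0 * v + x 0 1 * w = v ∧ x 1 0 * v + x 1 1 * w = w by
    obtain ⟨v, w, hne, h0, h1⟩ := h
    refine ⟨![v, w], fun h => ?_, ?_⟩
    · have hv : v = 0 := congrFun h 0
      have hw : w = 0 := congrFun h 1
      simp [hv, hw] at hne
    · ext i
      fin_cases i <;> simpa [mulVec, dotProduct, Fin.sum_univ_two]
  simp only [Quat, Paired, Monomial, Commute, SemiconjBy, GeneralLinearGroup.ext_iff, ne_eq,
    Fin.forall_fin_two, det_fin_two, Units.val_neg, Units.val_one, one_apply, mul_apply,
    GeneralLinearGroup.coe_mul, Matrix.neg_apply, Fin.sum_univ_two] at *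
  revert hx h
  generalize x 0 0 = a, x 0 1 = b, x 1 0 = c, x 1 1 = d
  revert a b c d
  decide

end GLTwoThree

/-! ### Subgroups of `GL₂(𝔽₃)`, classified through their intersection with the quaternion group. -/

namespace GLTwoThree

open Matrix

variable {H : Subgroup (GL (Fin 2) (ZMod 3))}

theorem det_mul_coe (x y : GL (Fin 2) (ZMod 3)) : (x * y).1.det = x.1.det * y.1.det := by
  rw [GeneralLinearGroup.coe_mul, det_mul]

theorem quat_mul_of_det_eq_neg_one {x y : GL (Fin 2) (ZMod 3)} (hx : x.1.det = -1)
    (hxp : Paired x) (hy : y.1.det = -1) (hyp : Paired y) : Quat (x * y) :=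
  ⟨by rw [det_mul_coe, hx, hy]; rfl, hxp.mul hyp⟩

theorem neg_one_ne_one : (-1 : GL (Fin 2) (ZMod 3)) ≠ 1 := by
  intro h
  have := congrArg (fun g : GL (Fin 2) (ZMod 3) => g 0 0) h
  revert this
  decide

theorem neg_mem (h : -1 ∈ H) {x : GL (Fin 2) (ZMod 3)} (hx : x ∈ H) : -x ∈ H := by
  simpa using mul_mem h hx

theorem orderOf_eq_four {x : GL (Fin 2) (ZMod 3)} (h : x * x = -1) : orderOf x = 4 := by
  refine orderOf_eq_prime_pow (p := 2) (n := 1) ?_ ?_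
  · simpa [pow_two, h] using neg_one_ne_one
  · rw [show 2 ^ (1 + 1) = 2 * 2 from rfl, pow_mul, pow_two x, h]
    simp

theorem orderOf_eq_eight {x : GL (Fin 2) (ZMod 3)} (h : x * x * (x * x) = -1) :
    orderOf x = 8 := by
  have h4 : x ^ (2 ^ 2) = -1 := by rw [← h, ← pow_two, ← pow_two, ← pow_mul]; rfl
  refine orderOf_eq_prime_pow (p := 2) (n := 2) ?_ ?_
  · rw [h4]
    exact neg_one_ne_one
  · rw [pow_succ, pow_mul, h4]
    simp

theorem orderOf_eq_six {x : GL (Fin 2) (ZMod 3)} (h : x * x * x = -1) (hx : x ≠ -1) :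
    orderOf x = 6 := by
  have h3 : x ^ 3 = -1 := by rw [← h, pow_succ, pow_two]
  refine orderOf_eq_of_pow_and_pow_div_prime (by norm_num) ?_ fun p hp hd => ?_
  · rw [show 6 = 3 * 2 from rfl, pow_mul, h3]
    simp
  · have hp' : p ∣ 2 * 3 := hd
    rcases (Nat.Prime.dvd_mul hp).1 hp' with h2 | h2
    · rw [(Nat.prime_dvd_prime_iff_eq hp Nat.prime_two).1 h2, show 6 / 2 = 3 from rfl, h3]
      exact neg_one_ne_one
    · rw [(Nat.prime_dvd_prime_iff_eq hp Nat.prime_three).1 h2, show 6 / 3 = 2 from rfl, pow_two]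
      exact fun hxx => hx (by rw [← h, hxx, one_mul])

/-! #### Subgroups of the quaternion group -/

theorem nonempty_mulEquiv_zmod_two (hH : ∀ g ∈ H, g = 1 ∨ g = -1) (hne : ∃ g ∈ H, g ≠ 1) :
    Nonempty (H ≃* Multiplicative (ZMod 2)) := by
  obtain ⟨g, hg, hg1⟩ := hne
  obtain rfl : g = -1 := (hH g hg).resolve_left hg1
  refine Subgroup.nonempty_mulEquiv_zmod hg
    (orderOf_eq_prime (by simp) neg_one_ne_one) fun x hx => ?_
  rcases hH x hx with rfl | rfl
  exacts [⟨0, by simp⟩, ⟨1, by simp⟩]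

theorem exists_pow_eq {x y : GL (Fin 2) (ZMod 3)} (h : x * x = -1)
    (hy : (y = 1 ∨ y = -1) ∨ y = x ∨ y = -x) : ∃ k : ℕ, y = x ^ k := by
  rcases hy with (rfl | rfl) | rfl | rfl
  · exact ⟨0, by simp⟩
  · exact ⟨2, by rw [pow_two, h]⟩
  · exact ⟨1, by simp⟩
  · exact ⟨3, by rw [pow_succ, pow_two, h, neg_one_mul]⟩

theorem nonempty_mulEquiv_zmod_four_of_monomial (hH : ∀ g ∈ H, Quat g)
    (hmon : ∀ g ∈ H, Monomial g) (hne : ∃ g ∈ H, g 1 0 ≠ 0) :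
    Nonempty (H ≃* Multiplicative (ZMod 4)) := by
  obtain ⟨g, hg, hg1⟩ := hne
  have h := (hH g hg).mul_self hg1
  exact Subgroup.nonempty_mulEquiv_zmod hg (orderOf_eq_four h) fun x hx =>
    exists_pow_eq h ((hH g hg).monomial_cases (hmon g hg) hg1 (hH x hx) (hmon x hx))

theorem nonempty_mulEquiv_zmod_four_of_not_monomial (hH : ∀ g ∈ H, Quat g)
    (hmon : ∀ g ∈ H, Monomial g → g 1 0 = 0) (hne : ∃ g ∈ H, ¬ Monomial g) :
    Nonempty (H ≃* Multiplicative (ZMod 4)) := by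
  obtain ⟨g, hg, hg1⟩ := hne
  have h := (hH g hg).mul_self_of_not_monomial hg1
  refine Subgroup.nonempty_mulEquiv_zmod hg (orderOf_eq_four h) fun x hx => exists_pow_eq h ?_
  by_cases hxm : Monomial x
  · exact .inl ((hH x hx).eq_one_or (hmon x hx hxm))
  · refine .inr (((hH g hg).not_monomial_cases hg1 (hH x hx) hxm).resolve_right fun h' => ?_)
    exact h'.2 (hmon _ (mul_mem hg hx) h'.1)

/-- Two non-commuting elements of the quaternion group generate it. -/
theorem quat_mem_of_not_commute {x y : GL (Fin 2) (ZMod 3)} (hx : x ∈ H) (hy : y ∈ H)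
    (hxq : Quat x) (hyq : Quat y) (h : ¬ Commute x y) {z : GL (Fin 2) (ZMod 3)} (hz : Quat z) :
    z ∈ H := by
  have hneg : -1 ∈ H := (hxq.mul_self_of_not_commute hyq h).1 ▸ mul_mem hx hx
  rcases hxq.cases_of_not_commute hyq h hz with
    ((rfl | rfl) | rfl | rfl) | (rfl | rfl) | rfl | rfl
  exacts [one_mem H, hneg, hx, neg_mem hneg hx, hy, neg_mem hneg hy, mul_mem hy hx,
    neg_mem hneg (mul_mem hy hx)]

theorem nonempty_mulEquiv_quaternionGroup (hH : ∀ g ∈ H, Quat g)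
    (hne : ∃ g ∈ H, ¬ Monomial g) (hmon : ∃ g ∈ H, Monomial g ∧ g 1 0 ≠ 0) :
    Nonempty (H ≃* QuaternionGroup 2) := by
  obtain ⟨x, hx, hxm⟩ := hne
  obtain ⟨y, hy, hym, hy1⟩ := hmon
  have hxy := (hH x hx).not_commute hxm (hH y hy) hym hy1
  obtain ⟨hxx, hyy, hxyx⟩ := (hH x hx).mul_self_of_not_commute (hH y hy) hxy
  refine Subgroup.nonempty_mulEquiv_quaternionGroup hx hy (orderOf_eq_four hxx)
    (hyy.trans hxx.symm) hxyx (fun k hk => hxy ?_) fun z hz => ?_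
  · rw [hk]
    exact Commute.self_pow x k
  · rcases (hH x hx).cases_of_not_commute (hH y hy) hxy (hH z hz) with h | h
    · obtain ⟨k, hk⟩ := exists_pow_eq hxx h
      exact ⟨k, .inl hk⟩
    · obtain ⟨k, hk⟩ := exists_pow_eq (y := y⁻¹ * z) hxx (by
        rcases h with (rfl | rfl) | rfl | rfl <;> simp)
      exact ⟨k, .inr (by rw [← hk, mul_inv_cancel_left])⟩

/-! #### Subgroups containing an element of order divisible by three -/

theorem Paired.one : Paired 1 := by
  simp [Paired, Monomial]

theorem Paired.neg_one : Paired (-1) := by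
  simp [Paired, Monomial]

theorem Paired.neg {x : GL (Fin 2) (ZMod 3)} (hx : Paired x) : Paired (-x) := by
  simpa using Paired.neg_one.mul hx

theorem exists_eq_pow_of_mem_zpowers {x y : GL (Fin 2) (ZMod 3)} (h : y ∈ Subgroup.zpowers x) :
    ∃ k : ℕ, y = x ^ k := by
  obtain ⟨k, hk⟩ := mem_powers_iff_mem_zpowers.2 h
  exact ⟨k, hk.symm⟩

/-- One of `y`, `y * x`, `y * x * x` lies in the quaternion group, so powers of `x` exhaust the
determinant-one part of `H` as soon as they contain its quaternion part. -/
theorem mem_zpowers_of_quat_mem {x y : GL (Fin 2) (ZMod 3)} (hx : x ∈ H) (hxd : x.1.det = 1)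
    (hxp : ¬ Paired x) (hy : y ∈ H) (hyd : y.1.det = 1)
    (hq : ∀ g ∈ H, Quat g → g ∈ Subgroup.zpowers x) : y ∈ Subgroup.zpowers x := by
  have hxz := Subgroup.mem_zpowers x
  rcases paired_coset hxd hxp hyd with h | h | h
  · exact hq y hy ⟨hyd, h⟩
  · have := hq _ (mul_mem hy hx) ⟨by rw [det_mul_coe, hxd, hyd, one_mul], h⟩
    exact (Subgroup.mul_mem_cancel_right _ hxz).1 this
  · have := hq _ (mul_mem (mul_mem hy hx) hx)
      ⟨by rw [det_mul_coe, det_mul_coe, hxd, hyd, one_mul, one_mul], h⟩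
    exact (Subgroup.mul_mem_cancel_right _ hxz).1 ((Subgroup.mul_mem_cancel_right _ hxz).1 this)

/-- If `H` meets the quaternion group trivially, then its elements of determinant one are the
powers of any element of order three. -/
theorem orderOf_eq_three_of_quat_trivial {x : GL (Fin 2) (ZMod 3)} (hx : x ∈ H)
    (hxd : x.1.det = 1) (hxp : ¬ Paired x) (hq : ∀ g ∈ H, Quat g → g = 1) :
    orderOf x = 3 ∧ ∀ y ∈ H, y.1.det = 1 → ∃ k : ℕ, y = x ^ k := by
  refine ⟨orderOf_eq_prime ?_ fun h => hxp (h ▸ Paired.one), fun y hy hyd =>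
    exists_eq_pow_of_mem_zpowers <| mem_zpowers_of_quat_mem hx hxd hxp hy hyd fun g hg hgq =>
      hq g hg hgq ▸ one_mem _⟩
  rcases pow_three_of_not_paired hxd hxp with h | h
  · rw [← h, pow_succ, pow_two]
  · have hm := mul_mem (mul_mem hx hx) hx
    rw [pow_succ, pow_two]
    refine hq _ hm ⟨by rw [det_mul_coe, det_mul_coe, hxd, one_mul, one_mul], ?_⟩
    rw [h]
    exact Paired.neg_one

/-- If `H` meets the quaternion group in its centre, then the elements of `H` of determinant one
are the powers of an element of order six. -/
theorem exists_orderOf_eq_six_of_quat_central (hne : ∃ g ∈ H, g.1.det = 1 ∧ ¬ Paired g)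
    (hq : ∀ g ∈ H, Quat g → g = 1 ∨ g = -1) (hneg : -1 ∈ H) :
    ∃ x ∈ H, x.1.det = 1 ∧ ¬ Paired x ∧ orderOf x = 6 ∧
      ∀ y ∈ H, y.1.det = 1 → ∃ k : ℕ, y = x ^ k := by
  obtain ⟨x, hx, hxd, hxp, hx3⟩ : ∃ x ∈ H, x.1.det = 1 ∧ ¬ Paired x ∧ x * x * x = -1 := by
    obtain ⟨x, hx, hxd, hxp⟩ := hne
    rcases pow_three_of_not_paired hxd hxp with h | h
    · refine ⟨-x, neg_mem hneg hx, ?_, fun h' => hxp (by simpa using h'.neg), by simp [h]⟩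
      rw [Units.val_neg, det_neg, hxd]
      rfl
    · exact ⟨x, hx, hxd, hxp, h⟩
  refine ⟨x, hx, hxd, hxp, orderOf_eq_six hx3 fun h => hxp (h ▸ Paired.neg_one),
    fun y hy hyd => exists_eq_pow_of_mem_zpowers <|
      mem_zpowers_of_quat_mem hx hxd hxp hy hyd fun g hg hgq => ?_⟩
  rcases hq g hg hgq with rfl | rfl
  · exact one_mem _
  · rw [← hx3]
    exact mul_mem (mul_mem (Subgroup.mem_zpowers x) (Subgroup.mem_zpowers x))
      (Subgroup.mem_zpowers x)

/-- The element `y` and its conjugate by `x` do not commute, hence generate the quaternion group;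
the cosets of the powers of `x` then fill `SL₂(𝔽₃)`. -/
theorem mem_of_det_eq_one {x y : GL (Fin 2) (ZMod 3)} (hx : x ∈ H) (hxd : x.1.det = 1)
    (hxp : ¬ Paired x) (hy : y ∈ H) (hyq : Quat y) (hym : ¬ Monomial y)
    {z : GL (Fin 2) (ZMod 3)} (hz : z.1.det = 1) : z ∈ H := by
  obtain ⟨hc, hnc⟩ := quat_conj hxd hxp hyq hym
  have hq {g : GL (Fin 2) (ZMod 3)} (hg : Quat g) : g ∈ H :=
    quat_mem_of_not_commute hy (mul_mem (mul_mem hx hy) (mul_mem hx hx)) hyq hc hnc hg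
  rcases paired_coset hxd hxp hz with h | h | h
  · exact hq ⟨hz, h⟩
  · exact (Subgroup.mul_mem_cancel_right _ hx).1
      (hq ⟨by rw [det_mul_coe, hxd, hz, one_mul], h⟩)
  · exact (Subgroup.mul_mem_cancel_right _ hx).1 ((Subgroup.mul_mem_cancel_right _ hx).1
      (hq ⟨by rw [det_mul_coe, det_mul_coe, hxd, hz, one_mul, one_mul], h⟩))

theorem nonempty_mulEquiv_zmod_three (hdet : ∀ g ∈ H, g.1.det = 1) (hne : ∃ g ∈ H, ¬ Paired g)
    (hq : ∀ g ∈ H, Paired g → g = 1) : Nonempty (H ≃* Multiplicative (ZMod 3)) := by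
  obtain ⟨x, hx, hxp⟩ := hne
  obtain ⟨h3, hgen⟩ := orderOf_eq_three_of_quat_trivial hx (hdet x hx) hxp
    fun g hg hgq => hq g hg hgq.2
  exact Subgroup.nonempty_mulEquiv_zmod hx h3 fun y hy => hgen y hy (hdet y hy)

theorem nonempty_mulEquiv_zmod_six (hdet : ∀ g ∈ H, g.1.det = 1) (hne : ∃ g ∈ H, ¬ Paired g)
    (hq : ∀ g ∈ H, Paired g → g = 1 ∨ g = -1) (hneg : -1 ∈ H) :
    Nonempty (H ≃* Multiplicative (ZMod 6)) := by
  obtain ⟨g, hg, hgp⟩ := hne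
  obtain ⟨x, hx, -, -, h6, hgen⟩ := exists_orderOf_eq_six_of_quat_central
    ⟨g, hg, hdet g hg, hgp⟩ (fun g hg hgq => hq g hg hgq.2) hneg
  exact Subgroup.nonempty_mulEquiv_zmod hx h6 fun y hy => hgen y hy (hdet y hy)

theorem nonempty_mulEquiv_specialLinearGroup (hdet : ∀ g ∈ H, g.1.det = 1)
    (hne : ∃ g ∈ H, ¬ Paired g) (hq : ∃ g ∈ H, Paired g ∧ ¬ Monomial g) :
    Nonempty (H ≃* SpecialLinearGroup (Fin 2) (ZMod 3)) := by
  obtain ⟨x, hx, hxp⟩ := hne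
  obtain ⟨y, hy, hyp, hym⟩ := hq
  refine Subgroup.nonempty_mulEquiv_of_range_eq SpecialLinearGroup.toGL
    SpecialLinearGroup.toGL_injective (le_antisymm ?_ fun g hg => ?_)
  · rintro _ ⟨g, rfl⟩
    exact mem_of_det_eq_one hx (hdet x hx) hxp hy ⟨hdet y hy, hyp⟩ hym g.det_coe
  · exact ⟨⟨g.1, hdet g hg⟩, Units.ext rfl⟩

/-- The powers of `x` are the kernel of the determinant on `H`, so the rest of `H` is the coset of
`y`; the determinant also separates `y` from the powers of `x`. -/
theorem nonempty_mulEquiv_dihedralGroup_of_det {x y : GL (Fin 2) (ZMod 3)} {n : ℕ} [NeZero n]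
    (hx : x ∈ H) (hxd : x.1.det = 1) (hy : y ∈ H) (hyd : y.1.det = -1) (hn : orderOf x = n)
    (hgen : ∀ z ∈ H, z.1.det = 1 → ∃ k : ℕ, z = x ^ k) (hyy : y * y = 1)
    (hyx : y * x * (y * x) = 1) : Nonempty (H ≃* DihedralGroup n) := by
  refine Subgroup.nonempty_mulEquiv_dihedralGroup hx hy hn hyy hyx (fun k hk => ?_) fun z hz => ?_
  · have : y.1.det = 1 := by
      rw [hk, Units.val_pow_eq_pow_val, det_pow, hxd, one_pow]
    rw [hyd] at this
    revert this
    decide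
  · rcases det_eq_one_or z with hzd | hzd
    · obtain ⟨k, hk⟩ := hgen z hz hzd
      exact ⟨k, .inl hk⟩
    · obtain ⟨k, hk⟩ := hgen _ (mul_mem hy hz) (by rw [det_mul_coe, hyd, hzd]; rfl)
      exact ⟨k, .inr (by rw [← hk, ← mul_assoc, hyy, one_mul])⟩

theorem nonempty_mulEquiv_dihedralGroup_three (hodd : ∃ g ∈ H, g.1.det = -1)
    (hne : ∃ g ∈ H, g.1.det = 1 ∧ ¬ Paired g) (hq : ∀ g ∈ H, Quat g → g = 1) :
    Nonempty (H ≃* DihedralGroup 3) := by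
  obtain ⟨x, hx, hxd, hxp⟩ := hne
  obtain ⟨y, hy, hyd⟩ := hodd
  obtain ⟨h3, hgen⟩ := orderOf_eq_three_of_quat_trivial hx hxd hxp hq
  -- Every element of determinant `-1` squares into the quaternion part of `H`, which is trivial
  -- here; applied to `y` and `y * x` this gives both dihedral relations.
  have hinv {g : GL (Fin 2) (ZMod 3)} (hg : g ∈ H) (hgd : g.1.det = -1) : g * g = 1 :=
    hq _ (mul_mem hg hg) ⟨by rw [det_mul_coe, hgd]; rfl, mul_self_paired hgd⟩
  exact nonempty_mulEquiv_dihedralGroup_of_det hx hxd hy hyd h3 hgen (hinv hy hyd)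
    (hinv (mul_mem hy hx) (by rw [det_mul_coe, hxd, hyd, mul_one]))

theorem nonempty_mulEquiv_dihedralGroup_six (hodd : ∃ g ∈ H, g.1.det = -1)
    (hne : ∃ g ∈ H, g.1.det = 1 ∧ ¬ Paired g) (hq : ∀ g ∈ H, Quat g → g = 1 ∨ g = -1)
    (hneg : -1 ∈ H) : Nonempty (H ≃* DihedralGroup 6) := by
  obtain ⟨x, hx, hxd, -, h6, hgen⟩ := exists_orderOf_eq_six_of_quat_central hne hq hneg
  obtain ⟨y, hy, hyd⟩ := hodd
  have hinv {g : GL (Fin 2) (ZMod 3)} (hg : g ∈ H) (hgd : g.1.det = -1) : g * g = 1 :=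
    mul_self_eq_one_of_det_eq_neg_one hgd <|
      hq _ (mul_mem hg hg) ⟨by rw [det_mul_coe, hgd]; rfl, mul_self_paired hgd⟩
  exact nonempty_mulEquiv_dihedralGroup_of_det hx hxd hy hyd h6 hgen (hinv hy hyd)
    (hinv (mul_mem hy hx) (by rw [det_mul_coe, hxd, hyd, mul_one]))

theorem nonempty_mulEquiv_generalLinearGroup (hodd : ∃ g ∈ H, g.1.det = -1)
    (hne : ∃ g ∈ H, g.1.det = 1 ∧ ¬ Paired g) (hq : ∃ g ∈ H, Quat g ∧ ¬ Monomial g) :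
    Nonempty (H ≃* GL (Fin 2) (ZMod 3)) := by
  obtain ⟨x, hx, hxd, hxp⟩ := hne
  obtain ⟨y, hy, hyq, hym⟩ := hq
  obtain ⟨w, hw, hwd⟩ := hodd
  obtain rfl : H = ⊤ := by
    refine eq_top_iff.2 fun z _ => ?_
    rcases det_eq_one_or z with hz | hz
    · exact mem_of_det_eq_one hx hxd hxp hy hyq hym hz
    · exact (Subgroup.mul_mem_cancel_right _ hw).1
        (mem_of_det_eq_one hx hxd hxp hy hyq hym (by rw [det_mul_coe, hz, hwd]; rfl))
  exact ⟨Subgroup.topEquiv⟩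

/-! #### Subgroups of the Sylow `2`-subgroup -/

/-- The determinant-one part of `H` lies in `{1, -1}`. Were it trivial, `H` would be generated by
one reflection and would fix a nonzero vector, against `hfix`. -/
theorem nonempty_mulEquiv_zmod_two_prod (hodd : ∃ g ∈ H, g.1.det = -1) (hP : ∀ g ∈ H, Paired g)
    (hc : ∀ g ∈ H, g.1.det = 1 → g 1 0 = 0)
    (hfix : ¬ ∃ v : Fin 2 → ZMod 3, v ≠ 0 ∧ ∀ g ∈ H, g.1 *ᵥ v = v) :
    Nonempty (H ≃* Multiplicative (ZMod 2) × Multiplicative (ZMod 2)) := by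
  obtain ⟨x, hx, hxd⟩ := hodd
  have hq (g) (hg : g ∈ H) (hgd : g.1.det = 1) : g = 1 ∨ g = -1 :=
    Quat.eq_one_or ⟨hgd, hP g hg⟩ (hc g hg hgd)
  have hxx : x * x = 1 := mul_self_eq_one_of_det_eq_neg_one hxd <|
    hq _ (mul_mem hx hx) (by rw [det_mul_coe, hxd]; rfl)
  have hneg : -1 ∈ H := by
    by_contra hneg
    refine hfix ?_
    obtain ⟨v, hv, hxv⟩ := exists_mulVec_eq_self hxd hxx
    refine ⟨v, hv, fun g hg => ?_⟩
    have h1 (g) (hg : g ∈ H) (hgd : g.1.det = 1) : g = 1 :=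
      (hq g hg hgd).resolve_right fun h => hneg (h ▸ hg)
    rcases det_eq_one_or g with hgd | hgd
    · simp [h1 g hg hgd]
    · have : g * x = 1 := h1 _ (mul_mem hg hx) (by rw [det_mul_coe, hgd, hxd]; rfl)
      rw [mul_right_cancel (this.trans hxx.symm), hxv]
  have hD : Nonempty (H ≃* DihedralGroup 2) :=
    nonempty_mulEquiv_dihedralGroup_of_det hneg (by rw [Units.val_neg, det_neg]; rfl) hx hxd
      (orderOf_eq_prime (by simp) neg_one_ne_one)
      (fun y hy hyd => by
        rcases hq y hy hyd with rfl | rfl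
        exacts [⟨0, by simp⟩, ⟨1, by simp⟩]) hxx (by simpa using hxx)
  obtain ⟨e⟩ := hD
  obtain ⟨e'⟩ := IsKleinFour.nonempty_mulEquiv (G₁ := DihedralGroup 2)
    (G₂ := Multiplicative (ZMod 2 × ZMod 2))
  exact ⟨(e.trans e').trans (MulEquiv.prodMultiplicative _ _)⟩

/-- A non-monomial `x` has determinant `-1` here, and `x * x` generates the monomial part of the
quaternion group, so `x` has order eight and generates `H`. -/
theorem nonempty_mulEquiv_zmod_eight (hP : ∀ g ∈ H, Paired g)
    (hmon : ∀ g ∈ H, g.1.det = 1 → Monomial g) (hne : ∃ g ∈ H, ¬ Monomial g) :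
    Nonempty (H ≃* Multiplicative (ZMod 8)) := by
  obtain ⟨x, hx, hxm⟩ := hne
  have hxd : x.1.det = -1 := (det_eq_one_or x).resolve_left fun h => hxm (hmon x hx h)
  obtain ⟨hm, h10⟩ := mul_self_of_not_monomial hxd (hP x hx) hxm
  have hQ := quat_mul_of_det_eq_neg_one hxd (hP x hx) hxd (hP x hx)
  have h4 := hQ.mul_self h10
  have hxz := Subgroup.mem_zpowers x
  have hq (g) (hg : g ∈ H) (hgd : g.1.det = 1) : g ∈ Subgroup.zpowers x := by
    obtain ⟨k, rfl⟩ := exists_pow_eq h4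
      (hQ.monomial_cases hm h10 ⟨hgd, hP g hg⟩ (hmon g hg hgd))
    exact pow_mem (mul_mem hxz hxz) k
  refine Subgroup.nonempty_mulEquiv_zmod hx (orderOf_eq_eight h4) fun y hy =>
    exists_eq_pow_of_mem_zpowers ?_
  rcases det_eq_one_or y with hyd | hyd
  · exact hq y hy hyd
  · exact (Subgroup.mul_mem_cancel_right _ hxz).1
      (hq _ (mul_mem hy hx) (by rw [det_mul_coe, hyd, hxd]; rfl))

theorem nonempty_mulEquiv_dihedralGroup_four (hodd : ∃ g ∈ H, g.1.det = -1)
    (hmon : ∀ g ∈ H, Monomial g) (hne : ∃ g ∈ H, g.1.det = 1 ∧ g 1 0 ≠ 0) :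
    Nonempty (H ≃* DihedralGroup 4) := by
  obtain ⟨x, hx, hxd, hx10⟩ := hne
  obtain ⟨y, hy, hyd⟩ := hodd
  have hQ : Quat x := ⟨hxd, (hmon x hx).paired⟩
  have h2 := hQ.mul_self hx10
  exact nonempty_mulEquiv_dihedralGroup_of_det hx hxd hy hyd (orderOf_eq_four h2)
    (fun z hz hzd => exists_pow_eq h2
      (hQ.monomial_cases (hmon x hx) hx10 ⟨hzd, (hmon z hz).paired⟩ (hmon z hz)))
    ((hmon y hy).mul_self hyd)
    ((hmon _ (mul_mem hy hx)).mul_self (by rw [det_mul_coe, hxd, hyd, mul_one]))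

/-- A subgroup of the Sylow `2`-subgroup not contained in `SL₂(𝔽₃)` is the whole Sylow subgroup as
soon as it contains an element of determinant one that is not monomial. -/
theorem mem_of_paired (hodd : ∃ g ∈ H, g.1.det = -1) (hP : ∀ g ∈ H, Paired g)
    (hne : ∃ g ∈ H, g.1.det = 1 ∧ ¬ Monomial g) {z : GL (Fin 2) (ZMod 3)} (hz : Paired z) :
    z ∈ H := by
  obtain ⟨x, hx, hxd⟩ := hodd
  obtain ⟨y, hy, hyd, hym⟩ := hne
  have hyq : Quat y := ⟨hyd, hP y hy⟩
  have hq {g : GL (Fin 2) (ZMod 3)} (hg : Quat g) : g ∈ H := by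
    rcases quat_conj_of_det_eq_neg_one hxd (hP x hx) hyq hym with h | h
    · exact quat_mem_of_not_commute hy (mul_mem (mul_mem hx hy) hx) hyq
        (quat_mul_of_det_eq_neg_one (by rw [det_mul_coe, hxd, hyd, mul_one])
          (hP _ (mul_mem hx hy)) hxd (hP x hx)) h hg
    · exact quat_mem_of_not_commute hy (mul_mem hx hx) hyq
        (quat_mul_of_det_eq_neg_one hxd (hP x hx) hxd (hP x hx)) h hg
  rcases det_eq_one_or z with hzd | hzd
  · exact hq ⟨hzd, hz⟩
  · exact (Subgroup.mul_mem_cancel_right _ hx).1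
      (hq (quat_mul_of_det_eq_neg_one hzd hz hxd (hP x hx)))

/-- An element of order eight. -/
def octic : GL (Fin 2) (ZMod 3) :=
  GeneralLinearGroup.mkOfDetNeZero !![1, 1; -1, 1] (by decide)

/-- The reflection in the first coordinate axis. -/
def reflection : GL (Fin 2) (ZMod 3) :=
  GeneralLinearGroup.mkOfDetNeZero !![1, 0; 0, -1] (by decide)

theorem nonempty_mulEquiv_semidihedralGroup16 (hodd : ∃ g ∈ H, g.1.det = -1)
    (hP : ∀ g ∈ H, Paired g) (hne : ∃ g ∈ H, g.1.det = 1 ∧ ¬ Monomial g) :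
    Nonempty (H ≃* SemidihedralGroup16) := by
  have hmem {z : GL (Fin 2) (ZMod 3)} (hz : Paired z) : z ∈ H := mem_of_paired hodd hP hne hz
  have ha : octic.1 = !![1, 1; -1, 1] := rfl
  have hb : reflection.1 = !![1, 0; 0, -1] := rfl
  have hap : Paired octic := by
    simp [Paired, ha]
  have hbm : Monomial reflection := by
    simp [Monomial, hb]
  have ham : ¬ Monomial octic := by
    simp [Monomial, ha]
  have had : octic.1.det = -1 := by rw [ha]; decide
  have hbd : reflection.1.det = -1 := by rw [hb]; decide
  obtain ⟨hm, h10⟩ := mul_self_of_not_monomial had hap ham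
  have hQ := quat_mul_of_det_eq_neg_one had hap had hap
  have h4 := hQ.mul_self h10
  have haz := Subgroup.mem_zpowers octic
  have hab : octic * reflection = reflection * octic ^ 3 := by
    apply Units.ext
    rw [Units.val_mul, Units.val_mul, Units.val_pow_eq_pow_val, ha, hb]
    decide
  have hbb : reflection * reflection = 1 := hbm.mul_self hbd
  -- Among paired matrices, those for which being monomial is equivalent to having determinant `1`
  -- form the subgroup of index two generated by `octic`; `reflection` represents the other coset.
  have hpow {z : GL (Fin 2) (ZMod 3)} (hz : Paired z) (h : Monomial z ↔ z.1.det = 1) :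
      ∃ k : ℕ, z = octic ^ k := by
    refine exists_eq_pow_of_mem_zpowers ?_
    have key {g : GL (Fin 2) (ZMod 3)} (hgm : Monomial g) (hgd : g.1.det = 1) :
        g ∈ Subgroup.zpowers octic := by
      obtain ⟨k, rfl⟩ := exists_pow_eq h4 (hQ.monomial_cases hm h10 ⟨hgd, hgm.paired⟩ hgm)
      exact pow_mem (mul_mem haz haz) k
    rcases det_eq_one_or z with hzd | hzd
    · exact key (h.2 hzd) hzd
    · refine (Subgroup.mul_mem_cancel_right _ haz).1 (key (hz.mul_monomial hap ?_ ham) ?_)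
      · rw [h, hzd]
        decide
      · rw [det_mul_coe, hzd, had]
        rfl
  refine Subgroup.nonempty_mulEquiv_semidihedralGroup16 (hmem hap) (hmem hbm.paired)
    (orderOf_eq_eight h4) hbb hab (fun k hk => ?_) fun z hz => ?_
  · have h3 : octic * reflection = reflection * octic := by
      rw [hk]
      exact (Commute.self_pow octic k).eq
    have h2 : octic ^ 3 = octic := mul_left_cancel (hab.symm.trans h3)
    have h1 : octic * octic = 1 := by
      refine mul_right_cancel (b := octic) ?_
      rw [one_mul, ← pow_two, ← pow_succ, h2]
    rw [h1, one_mul] at h4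
    exact neg_one_ne_one h4.symm
  · by_cases h : Monomial z ↔ z.1.det = 1
    · obtain ⟨k, hk⟩ := hpow (hP z hz) h
      exact ⟨k, .inl hk⟩
    · obtain ⟨k, hk⟩ := hpow (z := reflection * z) (hbm.paired.mul (hP z hz)) (by
        rw [hbm.mul_iff, det_mul_coe, hbd]
        rcases det_eq_one_or z with hzd | hzd <;> rw [hzd] at h ⊢ <;> revert h <;>
          by_cases hz' : Monomial z <;> simp only [hz', true_iff, false_iff] <;> decide)
      exact ⟨k, .inr (by rw [← hk, ← mul_assoc, hbb, one_mul])⟩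

end GLTwoThree

/-! ### Rational `3`-torsion points on curves with additive reduction -/

namespace WeierstrassCurve

open Polynomial

/-- On the curve, the `3`-division polynomial expresses that the tangent is an inflection line. -/
theorem eval_Ψ₃_eq {R : Type*} [CommRing R] (W : WeierstrassCurve R) {x y : R}
    (h : W.toAffine.Equation x y) :
    W.Ψ₃.eval x = (W.a₂ + 3 * x) * (2 * y + W.a₁ * x + W.a₃) ^ 2
      - (3 * x ^ 2 + 2 * W.a₂ * x + W.a₄ - W.a₁ * y) ^ 2
      - W.a₁ * (3 * x ^ 2 + 2 * W.a₂ * x + W.a₄ - W.a₁ * y) * (2 * y + W.a₁ * x + W.a₃) := by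
  have h := (Affine.equation_iff _ _).1 h
  simp only [Ψ₃, b₂, b₄, b₆, b₈, eval_add, eval_mul, eval_pow, eval_X, eval_C, eval_ofNat]
  linear_combination (-12 * x - W.a₁ ^ 2 - 4 * W.a₂) * h

/-- A root of the `3`-division polynomial is not the abscissa of a point of order two. -/
theorem two_mul_add_ne_zero_of_eval_Ψ₃ {F : Type*} [Field F] (W : WeierstrassCurve F)
    [W.IsElliptic] {x y : F} (h : W.toAffine.Equation x y) (hx : W.Ψ₃.eval x = 0) :
    2 * y + W.a₁ * x + W.a₃ ≠ 0 := by
  intro hψ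
  have hns := ((Affine.nonsingular_iff' _ _).1 (Affine.equation_iff_nonsingular.1 h)).2
  rw [W.eval_Ψ₃_eq h, hψ] at hx
  -- With one partial derivative zero, vanishing of `Ψ₃` kills the other too, so the point would be
  -- singular.
  have hN : 3 * x ^ 2 + 2 * W.a₂ * x + W.a₄ - W.a₁ * y = 0 := by
    refine pow_eq_zero_iff (two_ne_zero) |>.1 ?_
    linear_combination -hx
  rcases hns with h1 | h1
  · exact h1 (by linear_combination -hN)
  · exact h1 hψ

section Reduction

variable {R : Type*} [CommRing R] [IsDomain R] [IsDiscreteValuationRing R]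
variable {K : Type*} [Field K] [Algebra R K] [IsFractionRing R K]

open IsDiscreteValuationRing IsDedekindDomain.HeightOneSpectrum

/-- Since `3` is a unit, dividing by it makes the division polynomial monic with coefficients in
`R`, which is integrally closed. -/
theorem exists_algebraMap_eq_of_eval_Ψ₃ (W : WeierstrassCurve K) [IsIntegral R W]
    (h3 : IsUnit (3 : R)) {x : K} (hx : W.Ψ₃.eval x = 0) : ∃ r : R, algebraMap R K r = x := by
  obtain ⟨u, hu⟩ := h3.exists_left_inv
  refine IsIntegrallyClosed.isIntegral_iff.1 ⟨X ^ 4 + C (u * (integralModel R W).b₂) * X ^ 3 +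
    C (u * 3 * (integralModel R W).b₄) * X ^ 2 + C (u * 3 * (integralModel R W).b₆) * X +
    C (u * (integralModel R W).b₈), by monicity!, ?_⟩
  have hu' : algebraMap R K u * 3 = 1 := by
      rw [← map_ofNat (algebraMap R K) 3, ← map_mul, hu, map_one]
  simp only [Ψ₃, eval_add, eval_mul, eval_pow, eval_X, eval_C, eval_ofNat] at hx
  simp only [eval₂_add, eval₂_mul, eval₂_pow, eval₂_X, eval₂_C, eval₂_ofNat, map_mul,
    integralModel_b₂_eq,
    integralModel_b₄_eq, integralModel_b₆_eq, integralModel_b₈_eq, map_ofNat]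
  linear_combination algebraMap R K u * hx - x ^ 4 * hu'

theorem exists_algebraMap_eq_of_quadratic {y : K} (b c : R)
    (hy : y ^ 2 + algebraMap R K b * y + algebraMap R K c = 0) : ∃ r : R, algebraMap R K r = y := by
  refine IsIntegrallyClosed.isIntegral_iff.1 ⟨X ^ 2 + C b * X + C c, by monicity!, ?_⟩
  simpa using hy

/-- An equation `y² + a₁xy + a₃y = x³` with `π ∣ a₁` and `π³ ∣ a₃` is not minimal. -/
theorem not_isMinimal_of_dvd (W : WeierstrassCurve K) (hΔ : W.Δ ≠ 0) (C : VariableChange K)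
    (hu : C.u = 1) (h2 : (C • W).a₂ = 0) (h4 : (C • W).a₄ = 0) (h6 : (C • W).a₆ = 0) {ϖ r s : R}
    (hϖ : ϖ ∈ IsLocalRing.maximalIdeal R) (h0 : ϖ ≠ 0)
    (h1 : (C • W).a₁ = algebraMap R K (ϖ * r)) (h3 : (C • W).a₃ = algebraMap R K (ϖ ^ 3 * s)) :
    ¬ IsMinimal R W := by
  intro hW
  have hϖK : algebraMap R K ϖ ≠ 0 := by simpa using h0
  -- Scaling by `u = ϖ` divides each `aᵢ` by `ϖ ^ i`, which keeps the equation integral, and divides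
  -- `Δ` by `ϖ ^ 12`. The valuation is multiplicative, so `v Δ` strictly increases, against
  -- maximality.
  set D : VariableChange K := ⟨Units.mk0 _ hϖK, 0, 0, 0⟩ with hD
  have hint : IsIntegral R ((D * C) • W) := by
    rw [mul_smul]
    refine isIntegral_of_exists_lift R ⟨r, ?_⟩ ⟨0, ?_⟩ ⟨s, ?_⟩ ⟨0, ?_⟩ ⟨0, ?_⟩
    · rw [variableChange_a₁ (C • W) D]
      simp [h1, hD, hϖK]
    · rw [variableChange_a₂ (C • W) D]
      simp [h2, hD]
    · rw [variableChange_a₃ (C • W) D]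
      simp [h3, hD, hϖK]
    · rw [variableChange_a₄ (C • W) D]
      simp [h4, hD]
    · rw [variableChange_a₆ (C • W) D]
      simp [h6, hD]
  have hv : IsDedekindDomain.HeightOneSpectrum.valuation K (maximalIdeal R)
      (algebraMap R K ϖ) < 1 :=
    (valuation_lt_one_iff_mem _ _).2 hϖ
  set v := IsDedekindDomain.HeightOneSpectrum.valuation K (maximalIdeal R)
  have hΔ' : W.Δ = algebraMap R K ϖ ^ 12 * ((D * C) • W).Δ := by
    rw [variableChange_Δ]
    simp [VariableChange.mul_def, hD, hu, hϖK]
  have hmax := hW.val_Δ_maximal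
  have hle : v W.Δ ≤ v ((D * C) • W).Δ := by
    rw [hΔ', map_mul, map_pow]
    exact mul_le_of_le_one_left' (pow_le_one' hv.le 12)
  have e1 : (valuation_Δ_aux R ((1 : VariableChange K) • W) : WithZero (Multiplicative ℤ)) =
      v W.Δ := by
    rw [one_smul]
    exact valuation_Δ_aux_eq_of_isIntegral R W
  have e2 := valuation_Δ_aux_eq_of_isIntegral R ((D * C) • W)
  have hge : v ((D * C) • W).Δ ≤ v W.Δ := by
    rw [← e1]
    have := hmax.2 hint (by rw [← Subtype.coe_le_coe, e1, e2]; exact hle)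
    rw [← Subtype.coe_le_coe, e2] at this
    exact this
  have hne : v ((D * C) • W).Δ ≠ 0 := by
    rw [Valuation.ne_zero_iff]
    rintro h
    exact hΔ (by rw [hΔ', h, mul_zero])
  refine absurd hge (not_le.2 ?_)
  rw [hΔ', map_mul, map_pow]
  exact mul_lt_of_lt_one_left (zero_lt_iff.2 hne) (pow_lt_one₀ zero_le hv (by norm_num))

/-- If a curve with additive reduction, over a field whose residue characteristic is not three, has
a rational `3`-torsion point, then its discriminant is not a cube. -/
theorem HasAdditiveReduction.not_isCube_Δ (W : WeierstrassCurve K) [W.IsElliptic]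
    (hW : W.HasAdditiveReduction R) (h3 : IsUnit (3 : R)) {x y : K}
    (h : W.toAffine.Equation x y) (hx : W.Ψ₃.eval x = 0) (d : K) : d ^ 3 ≠ W.Δ := by
  intro hd
  have hmin : IsMinimal R W := hW.toIsMinimal
  have hΔ : W.Δ ≠ 0 := W.isUnit_Δ.ne_zero
  have hψ := W.two_mul_add_ne_zero_of_eval_Ψ₃ h hx
  have heq := (Affine.equation_iff' _ _).1 h
  set ψ := 2 * y + W.a₁ * x + W.a₃ with hψdef
  -- `ℓ` is the slope of the tangent at `(x, y)`; the next relation says that this tangent is an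
  -- inflection line.
  obtain ⟨ℓ, hℓ⟩ : ∃ ℓ, ℓ * ψ = 3 * x ^ 2 + 2 * W.a₂ * x + W.a₄ - W.a₁ * y :=
    ⟨_ / ψ, div_mul_cancel₀ _ hψ⟩
  have hℓ2 : ℓ ^ 2 + W.a₁ * ℓ - W.a₂ - 3 * x = 0 := by
    have := W.eval_Ψ₃_eq h
    rw [hx, ← hψdef, ← hℓ] at this
    refine (mul_eq_zero_iff_right (pow_ne_zero 2 hψ)).1 ?_
    linear_combination this
  obtain ⟨xr, hxr⟩ := W.exists_algebraMap_eq_of_eval_Ψ₃ h3 hx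
  set I := integralModel R W
  have ha₁ : algebraMap R K I.a₁ = W.a₁ := integralModel_a₁_eq R W
  have ha₂ : algebraMap R K I.a₂ = W.a₂ := integralModel_a₂_eq R W
  have ha₃ : algebraMap R K I.a₃ = W.a₃ := integralModel_a₃_eq R W
  have ha₄ : algebraMap R K I.a₄ = W.a₄ := integralModel_a₄_eq R W
  have ha₆ : algebraMap R K I.a₆ = W.a₆ := integralModel_a₆_eq R W
  obtain ⟨yr, hyr⟩ := exists_algebraMap_eq_of_quadratic (y := y) (I.a₁ * xr + I.a₃)
    (-(xr ^ 3 + I.a₂ * xr ^ 2 + I.a₄ * xr + I.a₆)) (by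
      simp only [map_add, map_mul, map_neg, map_pow, ha₁, ha₂, ha₃, ha₄, ha₆, hxr]
      linear_combination heq)
  obtain ⟨ℓr, hℓr⟩ := exists_algebraMap_eq_of_quadratic (y := ℓ) I.a₁ (-(I.a₂ + 3 * xr)) (by
      simp only [map_add, map_mul, map_neg, map_ofNat, ha₁, ha₂, hxr]
      linear_combination hℓ2)
  -- This change moves the point to the origin and its tangent to the line `y = 0`, leaving `y² +
  -- pxy + qy = x³`.
  set C : VariableChange K := ⟨1, x, ℓ, y⟩ with hC
  obtain ⟨p, hp⟩ : ∃ p, algebraMap R K p = (C • W).a₁ :=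
    ⟨I.a₁ + 2 * ℓr, by rw [variableChange_a₁]; simp [hC, ha₁, hℓr, map_ofNat]⟩
  obtain ⟨q, hq⟩ : ∃ q, algebraMap R K q = (C • W).a₃ :=
    ⟨I.a₃ + xr * I.a₁ + 2 * yr, by rw [variableChange_a₃]; simp [hC, ha₁, ha₃, hxr, hyr, map_ofNat]⟩
  have h2 : (C • W).a₂ = 0 := by
    simp only [variableChange_a₂, hC, inv_one, Units.val_one]
    linear_combination -hℓ2
  have h4 : (C • W).a₄ = 0 := by
    simp only [variableChange_a₄, hC, inv_one, Units.val_one]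
    linear_combination -hℓ + ℓ * hψdef
  have h6 : (C • W).a₆ = 0 := by
    simp only [variableChange_a₆, hC, inv_one, Units.val_one]
    linear_combination -heq
  have hΔ₀ : W.Δ = algebraMap R K (q ^ 3 * (p ^ 3 - 27 * q)) := by
    have : (C • W).Δ = W.Δ := by rw [variableChange_Δ]; simp [hC]
    rw [← this]
    simp only [WeierstrassCurve.Δ, b₂, b₄, b₆, b₈, h2, h4, h6, ← hp, ← hq]
    simp only [map_mul, map_sub, map_pow, map_ofNat]
    ring
  have hc₀ : W.c₄ = algebraMap R K (p * (p ^ 3 - 24 * q)) := by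
    have : (C • W).c₄ = W.c₄ := by rw [variableChange_c₄]; simp [hC]
    rw [← this]
    simp only [WeierstrassCurve.c₄, b₂, b₄, h2, h4, ← hp, ← hq]
    simp only [map_mul, map_sub, map_pow, map_ofNat]
    ring
  have hΔm : q ^ 3 * (p ^ 3 - 27 * q) ∈ IsLocalRing.maximalIdeal R :=
    (valuation_lt_one_iff_mem (maximalIdeal R) (K := K) _).1 (by
      have := hW.badReduction
      rwa [hΔ₀] at this)
  have hcm : p * (p ^ 3 - 24 * q) ∈ IsLocalRing.maximalIdeal R :=
    (valuation_lt_one_iff_mem (maximalIdeal R) (K := K) _).1 (by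
      have := hW.additiveReduction
      rwa [hc₀] at this)
  set m := IsLocalRing.maximalIdeal R
  have hm : m.IsPrime := inferInstance
  have h3m {z : R} (hz : 3 * z ∈ m) : z ∈ m := (Ideal.unit_mul_mem_iff_mem m h3).1 hz
  -- Both `Δ` and `c₄` lie in the maximal ideal. If `q` did not, then `p³ - 27q` would, together
  -- with `p` or with `p³ - 24q`; either way a multiple of `q` by a power of the unit `3` would lie
  -- there.
  have hqm : q ∈ m := by
    rcases hm.mem_or_mem hΔm with h | h
    · exact hm.mem_of_pow_mem 3 h
    rcases hm.mem_or_mem hcm with h' | h'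
    · refine h3m (h3m (h3m ?_))
      have := m.sub_mem (m.pow_mem_of_mem h' 3 (by norm_num)) h
      ring_nf at this ⊢
      exact this
    · refine h3m ?_
      have := m.sub_mem h' h
      ring_nf at this ⊢
      exact this
  have hpm : p ∈ m := by
    rcases hm.mem_or_mem hcm with h | h
    · exact h
    · refine hm.mem_of_pow_mem 3 ?_
      simpa using m.add_mem h (m.mul_mem_left 24 hqm)
  obtain ⟨ϖ, hϖ⟩ := IsDiscreteValuationRing.exists_irreducible R
  have hmϖ {z : R} : z ∈ m ↔ ϖ ∣ z := by
    rw [← Ideal.mem_span_singleton, ← hϖ.maximalIdeal_eq]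
  obtain ⟨r, hr⟩ := hmϖ.1 hpm
  have hq0 : q ≠ 0 := by
    rintro rfl
    simp [hΔ₀] at hΔ
  have hqK : algebraMap R K q ≠ 0 := by simpa using hq0
  -- As `Δ = q³(p³ - 27q)` is a cube, `d / q` is a cube root of `p³ - 27q`, hence integral.
  obtain ⟨c, hc⟩ : ∃ c : R, algebraMap R K c = d / algebraMap R K q := by
    refine IsIntegrallyClosed.isIntegral_iff.1
      ⟨X ^ 3 - Polynomial.C (p ^ 3 - 27 * q), by monicity!, ?_⟩
    simp only [eval₂_sub, eval₂_pow, eval₂_X, eval₂_C, div_pow, hd, hΔ₀, map_mul, map_pow]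
    field_simp
    ring
  have hc3 : c ^ 3 = p ^ 3 - 27 * q := by
    apply IsFractionRing.injective R K
    rw [map_pow, hc, div_pow, hd, hΔ₀, map_mul, map_pow]
    field_simp
  obtain ⟨c', hc'⟩ : ϖ ∣ c := by
    refine hϖ.prime.dvd_of_dvd_pow (n := 3) ?_
    rw [hc3, ← hmϖ]
    exact m.sub_mem (m.pow_mem_of_mem hpm 3 (by norm_num)) (m.mul_mem_left _ hqm)
  obtain ⟨u, hu⟩ := h3.exists_left_inv
  -- From `27q = p³ - c³` with `p = ϖr` and `c = ϖc'` one gets `q = ϖ³ s`, where `u` is the inverse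
  -- of `3`.
  refine not_isMinimal_of_dvd (R := R) W hΔ C rfl h2 h4 h6 (ϖ := ϖ) (r := r)
    (s := u ^ 3 * (r ^ 3 - c' ^ 3)) (hmϖ.2 dvd_rfl) hϖ.ne_zero (by rw [← hp, hr]) ?_ hmin
  rw [← hq]
  congr 1
  rw [hc', hr] at hc3
  have hu27 : u ^ 3 * 27 = 1 := by linear_combination (u ^ 2 * 9 + u * 3 + 1) * hu
  linear_combination (-q) * hu27 + u ^ 3 * hc3

end Reduction

end WeierstrassCurve

/-! ### The `3`-torsion points -/

namespace WeierstrassCurve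

open Polynomial

variable {F : Type*} [Field F] (W : WeierstrassCurve F)

/-- The condition is `2P = -P`. Away from the points of order two, `Ψ₃(x)` is `-(x(2P) - x)` times
the nonzero square `(2y + a₁x + a₃)²`, so it vanishes exactly when `2P = ±P`, and `2P = P` is
impossible for an affine point. -/
theorem three_nsmul_eq_zero_iff [DecidableEq F] [W.IsElliptic] {x y : F}
    (h : W.toAffine.Nonsingular x y) :
    3 • Affine.Point.some x y h = 0 ↔ W.Ψ₃.eval x = 0 := by
  have e3 : 3 • Affine.Point.some x y h = 0 ↔
      Affine.Point.some x y h + Affine.Point.some x y h = -Affine.Point.some x y h := by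
    rw [succ_nsmul, two_nsmul, add_eq_zero_iff_eq_neg]
  rw [e3]
  by_cases hψ : 2 * y + W.a₁ * x + W.a₃ = 0
  · have hy : y = W.toAffine.negY x y := by
      rw [Affine.negY]
      linear_combination hψ
    rw [Affine.Point.add_self_of_Y_eq hy]
    refine iff_of_false (fun h0 => ?_) fun h0 =>
      W.two_mul_add_ne_zero_of_eval_Ψ₃ h.1 h0 hψ
    exact Affine.Point.some_ne_zero h (neg_eq_zero.1 h0.symm)
  · have hy : y ≠ W.toAffine.negY x y := fun hy => hψ (by
      rw [Affine.negY] at hy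
      linear_combination hy)
    have hℓ : W.toAffine.slope x x y y * (2 * y + W.a₁ * x + W.a₃) =
        3 * x ^ 2 + 2 * W.a₂ * x + W.a₄ - W.a₁ * y := by
      rw [Affine.slope_of_Y_ne rfl hy, div_mul_eq_mul_div, div_eq_iff (sub_ne_zero.2 hy),
        Affine.negY]
      ring
    have key : W.Ψ₃.eval x = 0 ↔ W.toAffine.addX x x (W.toAffine.slope x x y y) = x := by
      have : W.Ψ₃.eval x = -(W.toAffine.addX x x (W.toAffine.slope x x y y) - x) *
          (2 * y + W.a₁ * x + W.a₃) ^ 2 := by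
        rw [W.eval_Ψ₃_eq h.1, ← hℓ, Affine.addX]
        ring
      rw [this, mul_eq_zero_iff_right (pow_ne_zero 2 hψ), neg_eq_zero, sub_eq_zero]
    rw [key, Affine.Point.add_self_of_Y_ne hy, Affine.Point.X_eq_iff
      (h₁ := Affine.nonsingular_add h h fun hxy => hy hxy.2) (h₂ := h)]
    refine ⟨Or.inr, fun h' => h'.resolve_left fun h'' => ?_⟩
    rw [← Affine.Point.add_self_of_Y_ne (h₁ := h) hy] at h''
    exact Affine.Point.some_ne_zero h (add_eq_left.1 h'')

theorem quartic_coeff_injective {R : Type*} [CommRing R] {a b c d e a' b' c' d' e' : R}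
    (h : C a * X ^ 4 + C b * X ^ 3 + C c * X ^ 2 + C d * X + C e =
      C a' * X ^ 4 + C b' * X ^ 3 + C c' * X ^ 2 + C d' * X + C e') :
    b = b' ∧ c = c' ∧ d = d' ∧ e = e' := by
  have h0 := congrArg (coeff · 0) h
  have h1 := congrArg (coeff · 1) h
  have h2 := congrArg (coeff · 2) h
  have h3 := congrArg (coeff · 3) h
  simp [coeff_X, coeff_C] at h0 h1 h2 h3
  exact ⟨h3, h2, h1, h0⟩

/-- Vieta's formulas for the `3`-division polynomial. -/
theorem vieta_Ψ₃ [IsAlgClosed F] (h3 : (3 : F) ≠ 0) {x₁ x₂ x₃ x₄ : F}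
    (hroots : W.Ψ₃.roots = {x₁, x₂, x₃, x₄}) :
    W.b₂ = -3 * (x₁ + x₂ + x₃ + x₄) ∧
      W.b₄ = x₁ * x₂ + x₁ * x₃ + x₁ * x₄ + x₂ * x₃ + x₂ * x₄ + x₃ * x₄ ∧
      W.b₆ = -(x₁ * x₂ * x₃ + x₁ * x₂ * x₄ + x₁ * x₃ * x₄ + x₂ * x₃ * x₄) ∧
      W.b₈ = 3 * (x₁ * x₂ * x₃ * x₄) := by
  have hp := (IsAlgClosed.splits W.Ψ₃).eq_prod_roots
  have hlead : W.Ψ₃.leadingCoeff = 3 := by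
    rw [leadingCoeff, W.natDegree_Ψ₃ h3, W.coeff_Ψ₃]
  rw [hlead, hroots] at hp
  have hΨ : W.Ψ₃ = C 3 * X ^ 4 + C W.b₂ * X ^ 3 + C (3 * W.b₄) * X ^ 2 + C (3 * W.b₆) * X +
      C W.b₈ := by
    simp only [Ψ₃, map_mul, C_ofNat]
  have hq : W.Ψ₃ = C 3 * X ^ 4 + C (-3 * (x₁ + x₂ + x₃ + x₄)) * X ^ 3 +
      C (3 * (x₁ * x₂ + x₁ * x₃ + x₁ * x₄ + x₂ * x₃ + x₂ * x₄ + x₃ * x₄)) * X ^ 2 +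
      C (-3 * (x₁ * x₂ * x₃ + x₁ * x₂ * x₄ + x₁ * x₃ * x₄ + x₂ * x₃ * x₄)) * X +
      C (3 * (x₁ * x₂ * x₃ * x₄)) := by
    rw [hp]
    simp only [Multiset.insert_eq_cons, Multiset.map_cons, Multiset.map_singleton,
      Multiset.prod_cons, Multiset.prod_singleton, map_mul, map_add, map_neg]
    ring
  obtain ⟨h₂, h₄, h₆, h₈⟩ := quartic_coeff_injective (hΨ.symm.trans hq)
  exact ⟨h₂, mul_left_cancel₀ h3 h₄, mul_left_cancel₀ h3 (by linear_combination h₆), h₈⟩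

section Coordinates

variable {W}

/-- The abscissa of a point, with the value `1` at infinity. -/
noncomputable def Affine.Point.xCoord (P : W.toAffine.Point) : F :=
  P.xRep 0

theorem Affine.Point.xCoord_some {x y : F} (h : W.toAffine.Nonsingular x y) :
    (Affine.Point.some x y h).xCoord = x := by
  simp [xCoord]

theorem Affine.Point.xCoord_eq_iff {P Q : W.toAffine.Point} (hP : P ≠ 0) (hQ : Q ≠ 0) :
    P.xCoord = Q.xCoord ↔ P = Q ∨ P = -Q := by
  rcases P with _ | ⟨x, y, h⟩
  · exact absurd rfl hP
  rcases Q with _ | ⟨x', y', h'⟩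
  · exact absurd rfl hQ
  rw [xCoord_some, xCoord_some, X_eq_iff]

theorem Affine.Point.xCoord_neg (P : W.toAffine.Point) : (-P).xCoord = P.xCoord := by
  simp [xCoord, xRep_neg]

theorem eval_xCoord_Ψ₃ [DecidableEq F] [W.IsElliptic] {P : W.toAffine.Point} (hP : P ≠ 0)
    (h3 : 3 • P = 0) : W.Ψ₃.eval P.xCoord = 0 := by
  rcases P with _ | ⟨x, y, h⟩
  · exact absurd rfl hP
  · rw [Affine.Point.xCoord_some]
    exact (W.three_nsmul_eq_zero_iff h).1 h3

theorem exists_point_of_eval_Ψ₃ [DecidableEq F] [W.IsElliptic] [IsAlgClosed F] {x : F}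
    (hx : W.Ψ₃.eval x = 0) : ∃ P : W.toAffine.Point, P ≠ 0 ∧ 3 • P = 0 ∧ P.xCoord = x := by
  obtain ⟨y, hy⟩ : ∃ y, W.toAffine.Equation x y := by
    have hdeg : (X ^ 2 + C (W.a₁ * x + W.a₃) * X -
        C (x ^ 3 + W.a₂ * x ^ 2 + W.a₄ * x + W.a₆)).degree = 2 := by
      compute_degree!
    obtain ⟨y, hy⟩ := IsAlgClosed.exists_root _ (hdeg.trans_ne (by norm_num))
    refine ⟨y, (Affine.equation_iff _ _).2 ?_⟩
    simp at hy
    linear_combination hy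
  have h := Affine.equation_iff_nonsingular.1 hy
  exact ⟨.some x y h, Affine.Point.some_ne_zero h, (W.three_nsmul_eq_zero_iff h).2 hx,
    Affine.Point.xCoord_some h⟩

/-- Over an algebraically closed field, the `3`-torsion has a basis `P, Q` for which the abscissae
of `P, Q, P + Q, P - Q` are the roots of the `3`-division polynomial in a prescribed order. -/
theorem exists_basis_points [DecidableEq F] [W.IsElliptic] [IsAlgClosed F]
    {x₁ x₂ x₃ x₄ : F} (hx : ∀ x, W.Ψ₃.eval x = 0 ↔ x = x₁ ∨ x = x₂ ∨ x = x₃ ∨ x = x₄)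
    (h12 : x₁ ≠ x₂) {P : W.toAffine.Point} (hP : P ≠ 0) (hP3 : 3 • P = 0) (hPx : P.xCoord = x₁) :
    ∃ Q : W.toAffine.Point, Q ≠ 0 ∧ 3 • Q = 0 ∧ Q.xCoord = x₂ ∧ P + Q ≠ 0 ∧ P - Q ≠ 0 ∧
      (P + Q).xCoord = x₃ ∧ (P - Q).xCoord = x₄ := by
  have h2 {R : W.toAffine.Point} (hR3 : 3 • R = 0) : R + R = -R := by
    rw [succ_nsmul, two_nsmul] at hR3
    exact eq_neg_of_add_eq_zero_left hR3
  have h2' {R : W.toAffine.Point} (hR : R ≠ 0) (hR3 : 3 • R = 0) : R + R ≠ 0 := by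
    rwa [h2 hR3, neg_ne_zero]
  have heq {R S : W.toAffine.Point} (hR3 : 3 • R = 0) (h : R + S = -R) : S = R := by
    rw [← add_sub_cancel_left R S, h, ← neg_add', h2 hR3, neg_neg]
  -- An abscissa `x₁` or `x₂` for `P + Q` would mean `P + Q = ±P` or `±Q`, hence `P = 0`, `Q = 0` or
  -- `P = Q`.
  have key {Q : W.toAffine.Point} (hQ : Q ≠ 0) (hQ3 : 3 • Q = 0) (hQx : Q.xCoord = x₂) :
      P + Q ≠ 0 ∧ ((P + Q).xCoord = x₃ ∨ (P + Q).xCoord = x₄) := by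
    have hne : P + Q ≠ 0 := fun h => h12 (by
      rw [← hPx, ← hQx, eq_neg_of_add_eq_zero_left h, Affine.Point.xCoord_neg])
    have hPQ : P ≠ Q := fun h => h12 (by rw [← hPx, ← hQx, h])
    refine ⟨hne, ?_⟩
    have h0 := eval_xCoord_Ψ₃ hne (by rw [nsmul_add, hP3, hQ3, add_zero])
    rcases (hx _).1 h0 with h | h | h
    · rw [← hPx, Affine.Point.xCoord_eq_iff hne hP] at h
      rcases h with h | h
      · exact absurd (add_eq_left.1 h) hQ
      · exact absurd (heq hP3 h).symm hPQ
    · rw [← hQx, Affine.Point.xCoord_eq_iff hne hQ] at h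
      rcases h with h | h
      · exact absurd (add_eq_right.1 h) hP
      · exact absurd (heq hQ3 (add_comm P Q ▸ h)) hPQ
    · exact h
  obtain ⟨Q, hQ, hQ3, hQx⟩ := exists_point_of_eval_Ψ₃ ((hx x₂).2 (by simp))
  have hQ' : -Q ≠ 0 := neg_ne_zero.2 hQ
  have hQ3' : 3 • -Q = 0 := by rw [smul_neg, hQ3, neg_zero]
  have hQx' : (-Q).xCoord = x₂ := by rw [Affine.Point.xCoord_neg, hQx]
  obtain ⟨hA, hAx⟩ := key hQ hQ3 hQx
  obtain ⟨hB, hBx⟩ := key hQ' hQ3' hQx'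
  have hne : (P + Q).xCoord ≠ (P + -Q).xCoord := by
    rw [Ne, Affine.Point.xCoord_eq_iff hA hB]
    rintro (h | h)
    · refine h2' hQ hQ3 ?_
      rw [add_right_inj] at h
      nth_rewrite 1 [h]
      exact neg_add_cancel Q
    · refine h2' hP hP3 ?_
      rw [neg_add, neg_neg, add_left_inj] at h
      nth_rewrite 1 [h]
      exact neg_add_cancel P
  -- `P + Q` and `P - Q` have different abscissae among `x₃, x₄`; the sign of `Q` puts them in the
  -- required order.
  rcases hAx with hAx | hAx
  · refine ⟨Q, hQ, hQ3, hQx, hA, by rwa [sub_eq_add_neg], hAx, ?_⟩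
    rw [sub_eq_add_neg]
    exact hBx.resolve_left fun h => hne (hAx.trans h.symm)
  · refine ⟨-Q, hQ', hQ3', hQx', hB, by rwa [sub_neg_eq_add], ?_, by rwa [sub_neg_eq_add]⟩
    exact hBx.resolve_right fun h => hne (hAx.trans h.symm)

end Coordinates

end WeierstrassCurve

/-! ### The Galois representation on the `3`-torsion -/

section LinearAlgebra

open Matrix

variable {A : Type*} [AddCommGroup A]

/-- The linear combination of two elements killed by `3` with coefficients modulo `3`. -/
def zmodThreeComb (P Q : A) (v : Fin 2 → ZMod 3) : A :=
  (v 0).val • P + (v 1).val • Q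

theorem zmodThreeComb_add {P Q : A} (hP : 3 • P = 0) (hQ : 3 • Q = 0) (v w : Fin 2 → ZMod 3) :
    zmodThreeComb P Q (v + w) = zmodThreeComb P Q v + zmodThreeComb P Q w := by
  have hadd {R : A} (hR : 3 • R = 0) (a b : ZMod 3) : (a + b).val • R = a.val • R + b.val • R := by
    rw [← add_nsmul, ZMod.val_add, ← nsmul_eq_mod_nsmul _ hR]
  rw [zmodThreeComb, zmodThreeComb, zmodThreeComb, add_add_add_comm]
  exact congrArg₂ (· + ·) (hadd hP _ _) (hadd hQ _ _)

theorem zmodThreeComb_neg {P Q : A} (hP : 3 • P = 0) (hQ : 3 • Q = 0) (v : Fin 2 → ZMod 3) :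
    zmodThreeComb P Q (-v) = -zmodThreeComb P Q v := by
  rw [eq_neg_iff_add_eq_zero, ← zmodThreeComb_add hP hQ, neg_add_cancel]
  simp [zmodThreeComb]

theorem zmodThreeComb_injective {P Q : A} (hP : 3 • P = 0) (hQ : 3 • Q = 0)
    (hind : ∀ v : Fin 2 → ZMod 3, zmodThreeComb P Q v = 0 → v = 0) :
    Function.Injective (zmodThreeComb P Q) := by
  intro v w h
  refine sub_eq_zero.1 (hind _ ?_)
  rw [sub_eq_add_neg, zmodThreeComb_add hP hQ, zmodThreeComb_neg hP hQ, h, add_neg_cancel]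

/-- The action of a group on the `3`-torsion in a given basis. -/
theorem exists_matrix_of_three_torsion_basis {G : Type*} [Group G] (φ : G →* AddMonoid.End A)
    {P Q : A} (hP : 3 • P = 0) (hQ : 3 • Q = 0)
    (hind : ∀ v : Fin 2 → ZMod 3, zmodThreeComb P Q v = 0 → v = 0)
    (hspan : ∀ R : A, 3 • R = 0 → ∃ v : Fin 2 → ZMod 3, R = zmodThreeComb P Q v) :
    ∃ ρ : G →* GL (Fin 2) (ZMod 3), ∀ g v,
      φ g (zmodThreeComb P Q v) = zmodThreeComb P Q ((ρ g).1 *ᵥ v) := by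
  let V : AddSubgroup A := (nsmulAddMonoidHom 3 : A →+ A).ker
  have hV (v : V) : 3 • v = 0 := Subtype.ext v.2
  let : Module (ZMod 3) V := AddCommGroup.zmodModule hV
  have hsmul (a : ZMod 3) (v : V) : ((a • v : V) : A) = a.val • (v : A) := rfl
  let p : V := ⟨P, hP⟩
  let q : V := ⟨Q, hQ⟩
  have hli : LinearIndependent (ZMod 3) ![p, q] := by
    rw [LinearIndependent.pair_iff]
    intro a b h
    have := hind ![a, b] (congrArg Subtype.val h)
    exact ⟨congrFun this 0, congrFun this 1⟩
  have hsp : ⊤ ≤ Submodule.span (ZMod 3) (Set.range ![p, q]) := by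
    rintro ⟨R, hR⟩ -
    obtain ⟨v, rfl⟩ := hspan R hR
    have : (⟨_, hR⟩ : V) = v 0 • p + v 1 • q := rfl
    rw [this]
    exact add_mem (Submodule.smul_mem _ _ (Submodule.subset_span ⟨0, rfl⟩))
      (Submodule.smul_mem _ _ (Submodule.subset_span ⟨1, rfl⟩))
  let b : Module.Basis (Fin 2) (ZMod 3) V := Module.Basis.mk hli hsp
  let ψ : G →* Module.End (ZMod 3) V :=
    { toFun := fun g => (((φ g).comp V.subtype).codRestrict V fun v => by
        change 3 • φ g v = 0
        rw [← map_nsmul]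
        exact (congrArg (φ g) v.2).trans (map_zero _)).toZModLinearMap 3
      map_one' := by
        ext v
        change φ 1 v = v
        rw [map_one]
        rfl
      map_mul' := fun g h => by
        ext v
        change φ (g * h) v = φ g (φ h v)
        rw [map_mul]
        rfl }
  refine ⟨(((LinearMap.toMatrixAlgEquiv b : _ →* _)).comp ψ).toHomUnits, fun g v => ?_⟩
  have hb (w : V) : (w : A) = zmodThreeComb P Q (b.repr w) := by
    conv_lhs => rw [← b.sum_repr w]
    simp [Fin.sum_univ_two, b, hsmul, p, q, zmodThreeComb]
  have hw : b.repr (v 0 • p + v 1 • q) = v := by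
    have hp : b 0 = p := by simp [b]
    have hq : b 1 = q := by simp [b]
    rw [← hp, ← hq]
    ext i
    fin_cases i <;> simp
  refine (hb (ψ g (v 0 • p + v 1 • q))).trans (congrArg _ ?_)
  conv_rhs => rw [← hw]
  exact (LinearMap.toMatrix_mulVec_repr b b (ψ g) _).symm

/-- The index of the line spanned by a vector of `𝔽₃²`, in the order: first axis, second axis,
diagonal, antidiagonal. -/
def lineIndex (v : Fin 2 → ZMod 3) : Fin 4 :=
  if v 1 = 0 then 0 else if v 0 = 0 then 1 else if v 0 = v 1 then 2 else 3

theorem zmodThreeComb_eq_or {P Q : A} (hP : 3 • P = 0) (hQ : 3 • Q = 0) {v : Fin 2 → ZMod 3}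
    (hv : v ≠ 0) : zmodThreeComb P Q v = ![P, Q, P + Q, P - Q] (lineIndex v) ∨
      zmodThreeComb P Q v = -![P, Q, P + Q, P - Q] (lineIndex v) := by
  have h2 {R : A} (hR : 3 • R = 0) : 2 • R = -R := by
    rw [succ_nsmul] at hR
    exact eq_neg_of_add_eq_zero_left hR
  obtain ⟨a, b, rfl⟩ : ∃ a b, v = ![a, b] := ⟨v 0, v 1, by ext i; fin_cases i <;> rfl⟩
  have hval0 : (0 : ZMod 3).val = 0 := rfl
  have hval1 : (1 : ZMod 3).val = 1 := rfl
  have hval2 : (2 : ZMod 3).val = 2 := rfl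
  have h01 : (0 : ZMod 3) ≠ 1 := by decide
  have h02 : (2 : ZMod 3) ≠ 0 := by decide
  have h12 : (1 : ZMod 3) ≠ 2 := by decide
  have hab : ∀ c : ZMod 3, c = 0 ∨ c = 1 ∨ c = 2 := by decide
  rcases hab a with rfl | rfl | rfl <;> rcases hab b with rfl | rfl | rfl
  · exact absurd (by ext i; fin_cases i <;> rfl) hv
  all_goals
    simp [zmodThreeComb, lineIndex, hval0, hval1, hval2, h2 hP, h2 hQ, h02, h12, h12.symm,
      sub_eq_add_neg, add_comm]

end LinearAlgebra

namespace WeierstrassCurve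

open Matrix

variable {K : Type*} [Field K] (W : WeierstrassCurve K) (Ω : Type*) [Field Ω] [Algebra K Ω]

open Classical in
/-- The action of the Galois group on the points. -/
noncomputable def pointAction : (Ω ≃ₐ[K] Ω) →* AddMonoid.End (W⁄Ω).toAffine.Point where
  toFun g := Affine.Point.map (g : Ω →ₐ[K] Ω)
  map_one' := by
    ext P
    cases P <;> rfl
  map_mul' g h := by
    ext P
    cases P <;> rfl

variable {W Ω}

instance [W.IsElliptic] : (W⁄Ω).IsElliptic :=
  inferInstanceAs (W.map (algebraMap K Ω)).IsElliptic

open Classical in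
theorem pointAction_some (g : Ω ≃ₐ[K] Ω) {x y : Ω} (h : (W⁄Ω).toAffine.Nonsingular x y) :
    ∃ h', W.pointAction Ω g (.some x y h) = .some (g x) (g y) h' :=
  ⟨_, rfl⟩

open Classical in
theorem xCoord_pointAction (g : Ω ≃ₐ[K] Ω) (P : (W⁄Ω).toAffine.Point) :
    (W.pointAction Ω g P).xCoord = g P.xCoord := by
  rcases P with _ | ⟨x, y, h⟩
  · exact (map_one g).symm
  · obtain ⟨h', e⟩ := pointAction_some g h
    rw [e, Affine.Point.xCoord_some, Affine.Point.xCoord_some]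

open Classical in
/-- A basis of the `3`-torsion adapted to a numbering of the abscissae, together with the matrix
representation of the Galois group in this basis. -/
structure ThreeTorsionFrame (W : WeierstrassCurve K) (x : Fin 4 → Ω) where
  /-- the first basis vector -/
  P : (W⁄Ω).toAffine.Point
  /-- the second basis vector -/
  Q : (W⁄Ω).toAffine.Point
  /-- the Galois representation -/
  ρ : (Ω ≃ₐ[K] Ω) →* GL (Fin 2) (ZMod 3)
  x_injective : Function.Injective x
  comb_injective : Function.Injective (zmodThreeComb P Q)
  three_nsmul_comb : ∀ v, 3 • zmodThreeComb P Q v = 0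
  exists_eq_comb : ∀ R : (W⁄Ω).toAffine.Point, 3 • R = 0 → ∃ v, R = zmodThreeComb P Q v
  pointAction_comb : ∀ g v,
    W.pointAction Ω g (zmodThreeComb P Q v) = zmodThreeComb P Q ((ρ g).1 *ᵥ v)
  xCoord_comb : ∀ v, v ≠ 0 → (zmodThreeComb P Q v).xCoord = x (lineIndex v)

-- Prescribing the ordinate `y` fixes the first basis vector itself and not only up to sign, which
-- is what lets `β` be read off from the matrices.
open Classical in
theorem exists_threeTorsionFrame [W.IsElliptic] [IsAlgClosed Ω] {x : Fin 4 → Ω}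
    (hx : Function.Injective x) (hroot : ∀ z, (W⁄Ω).Ψ₃.eval z = 0 ↔ ∃ i, z = x i)
    {y : Ω} (hy : (W⁄Ω).toAffine.Equation (x 0) y) :
    ∃ f : ThreeTorsionFrame W x, f.P = .some (x 0) y (Affine.equation_iff_nonsingular.1 hy) := by
  set P : (W⁄Ω).toAffine.Point := .some (x 0) y (Affine.equation_iff_nonsingular.1 hy) with hPdef
  have hP : P ≠ 0 := Affine.Point.some_ne_zero _
  have hP3 : 3 • P = 0 := ((W⁄Ω).three_nsmul_eq_zero_iff _).2 ((hroot _).2 ⟨0, rfl⟩)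
  obtain ⟨Q, hQ, hQ3, hQx, hA, hB, hAx, hBx⟩ := exists_basis_points (W := W⁄Ω) (x₁ := x 0)
    (x₂ := x 1) (x₃ := x 2) (x₄ := x 3) (fun z => (hroot z).trans (by simp [Fin.exists_fin_succ]))
    (hx.ne (by decide)) hP hP3 (Affine.Point.xCoord_some _)
  have hne (i : Fin 4) : ![P, Q, P + Q, P - Q] i ≠ 0 := by
    fin_cases i <;> assumption
  have hxi (i : Fin 4) : (![P, Q, P + Q, P - Q] i).xCoord = x i := by
    fin_cases i
    exacts [Affine.Point.xCoord_some _, hQx, hAx, hBx]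
  have hx' (v : Fin 2 → ZMod 3) (hv : v ≠ 0) : (zmodThreeComb P Q v).xCoord = x (lineIndex v) := by
    rcases zmodThreeComb_eq_or hP3 hQ3 hv with h | h
    · rw [h, hxi]
    · rw [h, Affine.Point.xCoord_neg, hxi]
  have hind (v : Fin 2 → ZMod 3) (h : zmodThreeComb P Q v = 0) : v = 0 := by
    by_contra hv
    rcases zmodThreeComb_eq_or hP3 hQ3 hv with h' | h'
    · exact hne _ (h'.symm.trans h)
    · exact hne _ (neg_eq_zero.1 (h'.symm.trans h))
  have hcomb3 (v : Fin 2 → ZMod 3) : 3 • zmodThreeComb P Q v = 0 := by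
    rw [zmodThreeComb, nsmul_add, nsmul_left_comm, hP3, nsmul_left_comm, hQ3]
    simp
  have hspan (R : (W⁄Ω).toAffine.Point) (hR : 3 • R = 0) : ∃ v, R = zmodThreeComb P Q v := by
    by_cases hR0 : R = 0
    · exact ⟨0, by simp [hR0, zmodThreeComb]⟩
    obtain ⟨i, hi⟩ := (hroot _).1 (eval_xCoord_Ψ₃ hR0 hR)
    have hline : ∀ i : Fin 4, ∃ v : Fin 2 → ZMod 3, v ≠ 0 ∧ lineIndex v = i := by
      intro i
      fin_cases i
      exacts [⟨![1, 0], by decide, by decide⟩, ⟨![0, 1], by decide, by decide⟩,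
        ⟨![1, 1], by decide, by decide⟩, ⟨![1, 2], by decide, by decide⟩]
    obtain ⟨v, hv, rfl⟩ := hline i
    have hv0 : zmodThreeComb P Q v ≠ 0 := fun h => hv (hind v h)
    rw [← hx' v hv, Affine.Point.xCoord_eq_iff hR0 hv0] at hi
    rcases hi with hi | hi
    · exact ⟨v, hi⟩
    · exact ⟨-v, by rw [hi, zmodThreeComb_neg hP3 hQ3]⟩
  obtain ⟨ρ, hρ⟩ := exists_matrix_of_three_torsion_basis (W.pointAction Ω) hP3 hQ3 hind hspan
  exact ⟨⟨P, Q, ρ, hx, zmodThreeComb_injective hP3 hQ3 hind, hcomb3, hspan, hρ, hx'⟩, rfl⟩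

end WeierstrassCurve

/-! ### Galois descent for separable elements -/

section Descent

variable {K Ω : Type*} [Field K] [Field Ω] [Algebra K Ω]

/-- A separable element lies in `K(S)` if and only if it is fixed by all automorphisms
fixing `S`. -/
theorem mem_adjoin_iff_forall_fixed [IsAlgClosure K Ω] {S : Set Ω} {x : Ω}
    (hx : IsSeparable K x) :
    x ∈ IntermediateField.adjoin K S ↔ ∀ g : Ω ≃ₐ[K] Ω, (∀ z ∈ S, g z = z) → g x = x := by
  have : IsAlgClosed Ω := IsAlgClosure.isAlgClosed K
  have : Normal K Ω := IsAlgClosure.normal K Ω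
  constructor
  · intro h g hg
    clear hx
    induction h using IntermediateField.adjoin_induction with
    | mem z hz => exact hg z hz
    | algebraMap z => exact g.commutes z
    | add _ _ _ _ h₁ h₂ => rw [map_add, h₁, h₂]
    | inv _ _ h => rw [map_inv₀, h]
    | mul _ _ _ _ h₁ h₂ => rw [map_mul, h₁, h₂]
  · intro h
    set F := IntermediateField.adjoin K S with hF
    have : Normal F Ω := Normal.tower_top_of_normal K F Ω
    by_contra hxF
    -- A separable element outside `K(S)` has another conjugate over `K(S)`, and normality provides
    -- an automorphism over `K(S)` carrying one to the other.
    obtain ⟨y, hxy, hconj⟩ := (notMem_iff_exists_ne_and_isConjRoot (K := F)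
      (IsSeparable.tower_top F hx) (IsAlgClosed.splits _)).1 (by
        rintro ⟨z, rfl⟩
        exact hxF z.2)
    obtain ⟨σ, rfl⟩ := isConjRoot_iff_exists_algEquiv.1 hconj.symm
    refine hxy (h (σ.restrictScalars K) fun z hz => ?_).symm
    exact σ.commutes ⟨z, IntermediateField.subset_adjoin K S hz⟩

/-- A simple root of a quadratic polynomial with separable coefficients is separable. -/
theorem isSeparable_of_quadratic {b c y : Ω} (hb : IsSeparable K b) (hc : IsSeparable K c)
    (hy : y ^ 2 + b * y + c = 0) (hd : 2 * y + b ≠ 0) : IsSeparable K y := by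
  open Polynomial in
  let E := separableClosure K Ω
  let b' : E := ⟨b, mem_separableClosure_iff.2 hb⟩
  let c' : E := ⟨c, mem_separableClosure_iff.2 hc⟩
  refine IsSeparable.of_algebra_isSeparable_of_isSeparable (E := E) K ?_
  have hdisc : b' ^ 2 - 4 * c' ≠ 0 := fun h => by
    have h' : b ^ 2 - 4 * c = 0 := congrArg Subtype.val h
    refine hd (pow_eq_zero_iff two_ne_zero |>.1 ?_)
    linear_combination h' + 4 * hy
  have hsep : (X ^ 2 + C b' * X + C c').Separable := by
    obtain ⟨u, hu⟩ : ∃ u, u * (b' ^ 2 - 4 * c') = 1 := ⟨_, inv_mul_cancel₀ hdisc⟩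
    -- Bézout relation from `(2X + b)² - 4(X² + bX + c) = b² - 4c`, valid in every characteristic.
    refine ⟨C (-4 * u), C u * (2 * X + C b'), ?_⟩
    have hu' := congrArg C hu
    simp only [map_mul, map_sub, map_pow, map_one, C_ofNat] at hu'
    simp only [derivative_add, derivative_X_pow, derivative_mul, derivative_C, derivative_X,
      map_mul, map_neg, C_ofNat]
    simp only [Nat.cast_ofNat, C_ofNat, Nat.add_one_sub_one, pow_one, zero_mul, mul_one, zero_add,
      add_zero]
    linear_combination hu'
  refine hsep.of_dvd (minpoly.dvd _ _ ?_)
  rw [map_add, map_add, map_mul, map_pow, aeval_X, aeval_C, aeval_C]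
  exact hy

end Descent

/-! ### The resolvent cubic -/

section Resolvent

variable {F : Type*} [Field F]

/-- The three conjugates of `c - 3 (x₀x₁ + x₂x₃)` under permutations of the `xᵢ`. -/
def cubicResolvent (c : F) (x : Fin 4 → F) : Fin 3 → F :=
  ![c - 3 * (x 0 * x 1 + x 2 * x 3), c - 3 * (x 0 * x 2 + x 1 * x 3),
    c - 3 * (x 0 * x 3 + x 1 * x 2)]

/-- The index of the partition of `{0, 1, 2, 3}` into pairs having `{i, j}` as a part. -/
def pairIndex (i j : Fin 4) : Fin 3 :=
  -- The bitwise sum of two distinct indices is `1`, `2` or `3`, and is the same for both pairs of a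
  -- partition. The diagonal `i = j` also falls in the last branch.
  if i.val ^^^ j.val = 1 then 0 else if i.val ^^^ j.val = 2 then 1 else 2

theorem cubicResolvent_pairIndex (c : F) (x : Fin 4 → F) {i j k l : Fin 4} (hij : i ≠ j)
    (hik : i ≠ k) (hil : i ≠ l) (hjk : j ≠ k) (hjl : j ≠ l) (hkl : k ≠ l) :
    c - 3 * (x i * x j + x k * x l) = cubicResolvent c x (pairIndex i j) := by
  have hcases : ∀ i j k l : Fin 4, i ≠ j → i ≠ k → i ≠ l → j ≠ k → j ≠ l → k ≠ l →
      ((i = 0 ∧ j = 1 ∨ i = 1 ∧ j = 0) ∧ (k = 2 ∧ l = 3 ∨ k = 3 ∧ l = 2) ∧ pairIndex i j = 0 ∨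
        (i = 2 ∧ j = 3 ∨ i = 3 ∧ j = 2) ∧ (k = 0 ∧ l = 1 ∨ k = 1 ∧ l = 0) ∧ pairIndex i j = 0) ∨
      ((i = 0 ∧ j = 2 ∨ i = 2 ∧ j = 0) ∧ (k = 1 ∧ l = 3 ∨ k = 3 ∧ l = 1) ∧ pairIndex i j = 1 ∨
        (i = 1 ∧ j = 3 ∨ i = 3 ∧ j = 1) ∧ (k = 0 ∧ l = 2 ∨ k = 2 ∧ l = 0) ∧ pairIndex i j = 1) ∨
      ((i = 0 ∧ j = 3 ∨ i = 3 ∧ j = 0) ∧ (k = 1 ∧ l = 2 ∨ k = 2 ∧ l = 1) ∧ pairIndex i j = 2 ∨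
        (i = 1 ∧ j = 2 ∨ i = 2 ∧ j = 1) ∧ (k = 0 ∧ l = 3 ∨ k = 3 ∧ l = 0) ∧ pairIndex i j = 2) := by
    decide
  have h₀ : cubicResolvent c x 0 = c - 3 * (x 0 * x 1 + x 2 * x 3) := rfl
  have h₁ : cubicResolvent c x 1 = c - 3 * (x 0 * x 2 + x 1 * x 3) := rfl
  have h₂ : cubicResolvent c x 2 = c - 3 * (x 0 * x 3 + x 1 * x 2) := rfl
  rcases hcases i j k l hij hik hil hjk hjl hkl with (h | h) | (h | h) | (h | h) <;>
    obtain ⟨⟨hi, hj⟩ | ⟨hi, hj⟩, ⟨hk, hl⟩ | ⟨hk, hl⟩, hp⟩ := h <;>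
    rw [hp, hi, hj, hk, hl] <;> simp only [h₀, h₁, h₂] <;> ring

end Resolvent

/-! ### The permutation of the lines of `𝔽₃²` -/

namespace GLTwoThree

open Matrix

/-- Spanning vectors of the four lines of `𝔽₃²`. -/
def lineVec : Fin 4 → Fin 2 → ZMod 3 :=
  ![![1, 0], ![0, 1], ![1, 1], ![1, 2]]

theorem lineVec_ne_zero : ∀ i, lineVec i ≠ 0 := by decide

theorem lineIndex_lineVec : ∀ i, lineIndex (lineVec i) = i := by decide

/-- The action of `GL₂(𝔽₃)` on the four lines of `𝔽₃²`. -/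
def linePerm (m : GL (Fin 2) (ZMod 3)) (i : Fin 4) : Fin 4 :=
  lineIndex (m.1 *ᵥ lineVec i)

theorem linePerm_eq (m : GL (Fin 2) (ZMod 3)) (i : Fin 4) :
    linePerm m i = lineIndex ![m 0 0 * lineVec i 0 + m 0 1 * lineVec i 1,
      m 1 0 * lineVec i 0 + m 1 1 * lineVec i 1] := by
  rw [linePerm]
  congr 1
  ext j
  fin_cases j <;> simp [mulVec, dotProduct, Fin.sum_univ_two]

theorem linePerm_zero_eq_zero_iff (m : GL (Fin 2) (ZMod 3)) : linePerm m 0 = 0 ↔ m 1 0 = 0 := by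
  rw [linePerm_eq]
  generalize m 0 0 = a, m 0 1 = b, m 1 0 = c, m 1 1 = d
  revert a b c d
  decide

theorem monomial_iff_linePerm (m : GL (Fin 2) (ZMod 3)) :
    Monomial m ↔ linePerm m 0 = 0 ∧ linePerm m 1 = 1 ∨ linePerm m 0 = 1 ∧ linePerm m 1 = 0 := by
  have h := m.det_ne_zero
  rw [det_fin_two] at h
  simp only [Monomial, linePerm_eq]
  revert h
  generalize m 0 0 = a, m 0 1 = b, m 1 0 = c, m 1 1 = d
  revert a b c d
  decide

theorem paired_iff_pairIndex (m : GL (Fin 2) (ZMod 3)) :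
    Paired m ↔ pairIndex (linePerm m 0) (linePerm m 1) = 0 := by
  have h := m.det_ne_zero
  rw [det_fin_two] at h
  simp only [Paired, Monomial, linePerm_eq]
  revert h
  generalize m 0 0 = a, m 0 1 = b, m 1 0 = c, m 1 1 = d
  revert a b c d
  decide

/-- Matrices of determinant `1` permute the four lines evenly, so they rotate the three partitions;
those of determinant `-1` reverse the cyclic order, whence the shift by `2 = -1` in the next
statement. -/
theorem pairIndex_of_det_eq_one {m : GL (Fin 2) (ZMod 3)} (h : m.1.det = 1) :
    pairIndex (linePerm m 0) (linePerm m 2) = pairIndex (linePerm m 0) (linePerm m 1) + 1 := by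
  rw [det_fin_two] at h
  simp only [linePerm_eq]
  revert h
  generalize m 0 0 = a, m 0 1 = b, m 1 0 = c, m 1 1 = d
  revert a b c d
  decide

theorem pairIndex_of_det_eq_neg_one {m : GL (Fin 2) (ZMod 3)} (h : m.1.det = -1) :
    pairIndex (linePerm m 0) (linePerm m 2) = pairIndex (linePerm m 0) (linePerm m 1) + 2 := by
  rw [det_fin_two] at h
  simp only [linePerm_eq]
  revert h
  generalize m 0 0 = a, m 0 1 = b, m 1 0 = c, m 1 1 = d
  revert a b c d
  decide

theorem linePerm_injective (m : GL (Fin 2) (ZMod 3)) : Function.Injective (linePerm m) := by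
  have h := m.det_ne_zero
  rw [det_fin_two] at h
  intro i j hij
  simp only [linePerm_eq] at hij
  revert hij h
  generalize m 0 0 = a, m 0 1 = b, m 1 0 = c, m 1 1 = d
  revert a b c d i j
  decide

end GLTwoThree

/-! ### The resolvent of the `3`-division polynomial -/

section Resolvent

variable {F : Type*} [Field F]

/-- By Vieta, the sum of the three values vanishes because `b₄` is the second symmetric function of
the roots, and the quadratic relation is `4b₈ = b₂b₆ - b₄²`. Together they say that the resolvent
cubic is `T³ - c` for a constant `c`. -/
theorem WeierstrassCurve.cubicResolvent_relations (W : WeierstrassCurve F) [IsAlgClosed F]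
    (h3 : (3 : F) ≠ 0) {x : Fin 4 → F} (hroots : W.Ψ₃.roots = {x 0, x 1, x 2, x 3}) :
    cubicResolvent W.b₄ x 2 = -(cubicResolvent W.b₄ x 0 + cubicResolvent W.b₄ x 1) ∧
      cubicResolvent W.b₄ x 0 ^ 2 + cubicResolvent W.b₄ x 0 * cubicResolvent W.b₄ x 1 +
        cubicResolvent W.b₄ x 1 ^ 2 = 0 := by
  obtain ⟨h₂, h₄, h₆, h₈⟩ := W.vieta_Ψ₃ h3 hroots
  have hb := W.b_relation
  have e₀ : cubicResolvent W.b₄ x 0 = W.b₄ - 3 * (x 0 * x 1 + x 2 * x 3) := rfl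
  have e₁ : cubicResolvent W.b₄ x 1 = W.b₄ - 3 * (x 0 * x 2 + x 1 * x 3) := rfl
  have e₂ : cubicResolvent W.b₄ x 2 = W.b₄ - 3 * (x 0 * x 3 + x 1 * x 2) := rfl
  rw [e₀, e₁, e₂]
  rw [h₂, h₆, h₈] at hb
  constructor
  · linear_combination 3 * h₄
  · rw [h₄] at hb ⊢
    linear_combination 3 * hb

/-- The values of the resolvent are `δ, ωδ, ω²δ` for a cube root of unity `ω`. -/
theorem WeierstrassCurve.exists_cubicResolvent_eq (W : WeierstrassCurve F) [IsAlgClosed F]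
    (h3 : (3 : F) ≠ 0) {x : Fin 4 → F} (hroots : W.Ψ₃.roots = {x 0, x 1, x 2, x 3})
    {ζ : F} (hζ : ζ ^ 2 + ζ + 1 = 0) :
    ∃ ω, (ω = ζ ∨ ω = ζ ^ 2) ∧ ω ^ 2 + ω + 1 = 0 ∧
      ∀ i, cubicResolvent W.b₄ x (i + 1) = ω * cubicResolvent W.b₄ x i := by
  obtain ⟨h, h'⟩ := W.cubicResolvent_relations h3 hroots
  have key (ω : F) (hω : ω ^ 2 + ω + 1 = 0)
      (h₁ : cubicResolvent W.b₄ x 1 = ω * cubicResolvent W.b₄ x 0) (i : Fin 3) :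
      cubicResolvent W.b₄ x (i + 1) = ω * cubicResolvent W.b₄ x i := by
    fin_cases i
    · exact h₁
    · change cubicResolvent W.b₄ x 2 = ω * cubicResolvent W.b₄ x 1
      linear_combination h + (-1 - ω) * h₁ - cubicResolvent W.b₄ x 0 * hω
    · change cubicResolvent W.b₄ x 0 = ω * cubicResolvent W.b₄ x 2
      linear_combination -ω * h + ω * h₁ + cubicResolvent W.b₄ x 0 * hω
  have hprod : (cubicResolvent W.b₄ x 1 - ζ * cubicResolvent W.b₄ x 0) *
      (cubicResolvent W.b₄ x 1 - ζ ^ 2 * cubicResolvent W.b₄ x 0) = 0 := by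
    linear_combination h' + (-cubicResolvent W.b₄ x 0 * cubicResolvent W.b₄ x 1 +
      cubicResolvent W.b₄ x 0 ^ 2 * (ζ - 1)) * hζ
  rcases mul_eq_zero.1 hprod with h₁ | h₁
  · exact ⟨ζ, .inl rfl, hζ, key ζ hζ (sub_eq_zero.1 h₁)⟩
  · have hζ' : (ζ ^ 2) ^ 2 + ζ ^ 2 + 1 = 0 := by linear_combination (ζ ^ 2 - ζ + 1) * hζ
    exact ⟨ζ ^ 2, .inr rfl, hζ', key _ hζ' (sub_eq_zero.1 h₁)⟩

theorem cubicResolvent_injective {c ω : F} {x : Fin 4 → F} (h3 : (3 : F) ≠ 0)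
    (hω : ω ^ 2 + ω + 1 = 0) (h : ∀ i, cubicResolvent c x (i + 1) = ω * cubicResolvent c x i)
    (h0 : cubicResolvent c x 0 ≠ 0) : Function.Injective (cubicResolvent c x) := by
  have hω1 : ω ≠ 1 := by
    rintro rfl
    exact h3 (by linear_combination hω)
  have hω0 : ω ≠ 0 := by
    rintro rfl
    simp at hω
  have hne (i : Fin 3) : cubicResolvent c x i ≠ 0 := by
    fin_cases i
    · exact h0
    · exact (h 0).trans_ne (mul_ne_zero hω0 h0)
    · exact (h 1).trans_ne (mul_ne_zero hω0 ((h 0).trans_ne (mul_ne_zero hω0 h0)))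
  have hstep (i : Fin 3) : cubicResolvent c x (i + 1) ≠ cubicResolvent c x i := fun e => by
    rw [h, mul_eq_right₀ (hne i)] at e
    exact hω1 e
  have hcase : ∀ i j : Fin 3, i = j ∨ i = j + 1 ∨ j = i + 1 := by decide
  intro i j hij
  rcases hcase i j with h | rfl | rfl
  · exact h
  · exact absurd hij (hstep j)
  · exact absurd hij.symm (hstep i)

/-- Differences of resolvent values factor, as in `-3(x₀ - x₃)(x₁ - x₂)`, so equality of two roots
makes two values coincide. Thus `Δ ≠ 0` yields four distinct roots. -/
theorem injective_of_cubicResolvent_injective {c : F} {x : Fin 4 → F}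
    (h : Function.Injective (cubicResolvent c x)) : Function.Injective x := by
  have e₀ : cubicResolvent c x 0 = c - 3 * (x 0 * x 1 + x 2 * x 3) := rfl
  have e₁ : cubicResolvent c x 1 = c - 3 * (x 0 * x 2 + x 1 * x 3) := rfl
  have e₂ : cubicResolvent c x 2 = c - 3 * (x 0 * x 3 + x 1 * x 2) := rfl
  have h₀₁ : cubicResolvent c x 0 ≠ cubicResolvent c x 1 := h.ne (by decide)
  have h₀₂ : cubicResolvent c x 0 ≠ cubicResolvent c x 2 := h.ne (by decide)
  have h₁₂ : cubicResolvent c x 1 ≠ cubicResolvent c x 2 := h.ne (by decide)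
  have hcase : ∀ i j : Fin 4, i = j ∨
      (i = 0 ∧ j = 1 ∨ i = 1 ∧ j = 0) ∨ (i = 2 ∧ j = 3 ∨ i = 3 ∧ j = 2) ∨
      (i = 0 ∧ j = 2 ∨ i = 2 ∧ j = 0) ∨ (i = 1 ∧ j = 3 ∨ i = 3 ∧ j = 1) ∨
      (i = 0 ∧ j = 3 ∨ i = 3 ∧ j = 0) ∨ (i = 1 ∧ j = 2 ∨ i = 2 ∧ j = 1) := by decide
  intro i j hij
  rcases hcase i j with h | (⟨rfl, rfl⟩ | ⟨rfl, rfl⟩) | (⟨rfl, rfl⟩ | ⟨rfl, rfl⟩) |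
    (⟨rfl, rfl⟩ | ⟨rfl, rfl⟩) | (⟨rfl, rfl⟩ | ⟨rfl, rfl⟩) | (⟨rfl, rfl⟩ | ⟨rfl, rfl⟩) |
    (⟨rfl, rfl⟩ | ⟨rfl, rfl⟩)
  · exact h
  iterate 4 exact absurd (by rw [e₁, e₂]; grind) h₁₂
  iterate 4 exact absurd (by rw [e₀, e₂]; grind) h₀₂
  iterate 4 exact absurd (by rw [e₀, e₁]; grind) h₀₁

end Resolvent

/-! ### The dictionary between the Galois action on the roots and matrices. -/

namespace WeierstrassCurve.ThreeTorsionFrame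

open Matrix GLTwoThree

variable {K : Type*} [Field K] {W : WeierstrassCurve K} {Ω : Type*} [Field Ω] [Algebra K Ω]
  {x : Fin 4 → Ω} (f : ThreeTorsionFrame W x) (g : Ω ≃ₐ[K] Ω)

theorem apply_x (i : Fin 4) : g (x i) = x (linePerm (f.ρ g) i) := by
  have hne : (f.ρ g).1 *ᵥ lineVec i ≠ 0 := fun h =>
    lineVec_ne_zero i (mulVec_injective_of_isUnit (f.ρ g).isUnit (h.trans (mulVec_zero _).symm))
  rw [linePerm, ← f.xCoord_comb _ hne, ← f.pointAction_comb, xCoord_pointAction,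
    f.xCoord_comb _ (lineVec_ne_zero i), lineIndex_lineVec]

theorem apply_x_zero_eq_iff : g (x 0) = x 0 ↔ f.ρ g 1 0 = 0 := by
  rw [f.apply_x, f.x_injective.eq_iff, linePerm_zero_eq_zero_iff]

/-- The sum and product determine the set `{x 0, x 1}` as the roots of a quadratic, and this set is
the pair of coordinate axes. -/
theorem apply_add_mul_eq_iff :
    g (x 0 + x 1) = x 0 + x 1 ∧ g (x 0 * x 1) = x 0 * x 1 ↔ Monomial (f.ρ g) := by
  rw [map_add, map_mul, f.apply_x, f.apply_x, monomial_iff_linePerm]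
  constructor
  · rintro ⟨hs, ht⟩
    have h₀ : (x (linePerm (f.ρ g) 0) - x 0) * (x (linePerm (f.ρ g) 0) - x 1) = 0 := by
      linear_combination x (linePerm (f.ρ g) 0) * hs - ht
    rcases mul_eq_zero.1 h₀ with h | h <;> rw [sub_eq_zero] at h
    · refine .inl ⟨f.x_injective h, f.x_injective ?_⟩
      linear_combination hs - h
    · refine .inr ⟨f.x_injective h, f.x_injective ?_⟩
      linear_combination hs - h
  · rintro (⟨h, h'⟩ | ⟨h, h'⟩) <;> rw [h, h']
    · exact ⟨rfl, rfl⟩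
    · exact ⟨add_comm _ _, mul_comm _ _⟩

theorem apply_cubicResolvent_zero (c : K) :
    g (cubicResolvent (algebraMap K Ω c) x 0) = cubicResolvent (algebraMap K Ω c) x
      (pairIndex (linePerm (f.ρ g) 0) (linePerm (f.ρ g) 1)) := by
  have hne {i j : Fin 4} (h : i ≠ j) := (linePerm_injective (f.ρ g)).ne h
  rw [← cubicResolvent_pairIndex _ x (hne (by decide)) (hne (i := 0) (j := 2) (by decide))
    (hne (i := 0) (j := 3) (by decide)) (hne (by decide)) (hne (by decide)) (hne (by decide))]
  change g (_ - 3 * (x 0 * x 1 + x 2 * x 3)) = _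
  simp only [map_sub, map_mul, map_add, map_ofNat, f.apply_x, g.commutes]

theorem apply_cubicResolvent_one (c : K) :
    g (cubicResolvent (algebraMap K Ω c) x 1) = cubicResolvent (algebraMap K Ω c) x
      (pairIndex (linePerm (f.ρ g) 0) (linePerm (f.ρ g) 2)) := by
  have hne {i j : Fin 4} (h : i ≠ j) := (linePerm_injective (f.ρ g)).ne h
  rw [← cubicResolvent_pairIndex _ x (hne (by decide)) (hne (i := 0) (j := 1) (by decide))
    (hne (i := 0) (j := 3) (by decide)) (hne (by decide)) (hne (by decide)) (hne (by decide))]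
  change g (_ - 3 * (x 0 * x 2 + x 1 * x 3)) = _
  simp only [map_sub, map_mul, map_add, map_ofNat, f.apply_x, g.commutes]

theorem apply_cubicResolvent_zero_eq_iff {c : K}
    (h : Function.Injective (cubicResolvent (algebraMap K Ω c) x)) :
    g (cubicResolvent (algebraMap K Ω c) x 0) = cubicResolvent (algebraMap K Ω c) x 0 ↔
      Paired (f.ρ g) := by
  rw [f.apply_cubicResolvent_zero, h.eq_iff, paired_iff_pairIndex]

/-- `ω` is the ratio of consecutive resolvent values: it is preserved when the cyclic order of the
partitions is preserved, and inverted when that order is reversed. This replaces the Weil pairing.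
-/
theorem apply_ω_eq_iff (h3 : (3 : Ω) ≠ 0) {c : K} {ω : Ω} (hω : ω ^ 2 + ω + 1 = 0)
    (h : ∀ i, cubicResolvent (algebraMap K Ω c) x (i + 1) =
      ω * cubicResolvent (algebraMap K Ω c) x i)
    (h0 : cubicResolvent (algebraMap K Ω c) x 0 ≠ 0) : g ω = ω ↔ (f.ρ g).1.det = 1 := by
  have hg := congrArg g (h 0)
  rw [map_mul, zero_add, f.apply_cubicResolvent_one, f.apply_cubicResolvent_zero] at hg
  have hne := (f.apply_cubicResolvent_zero g c).symm.trans_ne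
    ((map_ne_zero_iff g g.injective).2 h0)
  rcases det_eq_one_or (f.ρ g) with hd | hd
  · refine iff_of_true ?_ hd
    rw [pairIndex_of_det_eq_one hd, h] at hg
    exact (mul_right_cancel₀ hne hg).symm
  · refine iff_of_false ?_ (hd.trans_ne (by decide))
    intro hω'
    have h2 (i : Fin 3) : i + 2 = i + 1 + 1 := by revert i; decide
    rw [pairIndex_of_det_eq_neg_one hd, h2, h, h, ← mul_assoc, hω'] at hg
    have := mul_right_cancel₀ hne hg
    have hω0 : ω ≠ 0 := by
      rintro rfl
      simp at hω
    have h1 := (mul_eq_left₀ hω0).1 this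
    rw [h1] at hω
    exact h3 (by linear_combination hω)

theorem apply_basis_eq_iff {y : Ω} {h : (W⁄Ω).toAffine.Nonsingular (x 0) y}
    (hP : f.P = .some (x 0) y h) : g (x 0) = x 0 ∧ g y = y ↔ f.ρ g 0 0 = 1 ∧ f.ρ g 1 0 = 0 := by
  classical
  have hcomb : zmodThreeComb f.P f.Q ![1, 0] = f.P := by
    change 1 • f.P + 0 • f.Q = f.P
    simp
  have hact := f.pointAction_comb g ![1, 0]
  have hv : (f.ρ g).1 *ᵥ ![1, 0] = ![f.ρ g 0 0, f.ρ g 1 0] := by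
    ext i
    fin_cases i <;> simp [mulVec, dotProduct, Fin.sum_univ_two]
  obtain ⟨h', e⟩ := pointAction_some g h
  rw [hcomb, hP, e, hv, ← hP] at hact
  have hiff : zmodThreeComb f.P f.Q ![f.ρ g 0 0, f.ρ g 1 0] = zmodThreeComb f.P f.Q ![1, 0] ↔
      f.ρ g 0 0 = 1 ∧ f.ρ g 1 0 = 0 := by
    rw [f.comb_injective.eq_iff]
    simp
  rw [← hiff, ← hact, hcomb, hP, Affine.Point.some.injEq]

end WeierstrassCurve.ThreeTorsionFrame

/-! ### The Galois group of the `3`-torsion field as a matrix group -/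

namespace WeierstrassCurve

open Matrix GLTwoThree

variable {K : Type*} [Field K] {W : WeierstrassCurve K} {Ω : Type*} [Field Ω] [Algebra K Ω]

theorem eval_Ψ₃_baseChange (z : Ω) : (W⁄Ω).Ψ₃.eval z = Polynomial.aeval z W.Ψ₃ := by
  change (W.map (algebraMap K Ω)).Ψ₃.eval z = _
  rw [map_Ψ₃, Polynomial.eval_map_algebraMap]

/-- The torsion field is stable under the Galois group. -/
theorem normal_torsionField [Normal K Ω] (m : ℕ) : Normal K (W.torsionField Ω m) := by
  classical
  rw [IntermediateField.normal_iff_forall_map_le']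
  intro σ
  rw [torsionField, IntermediateField.adjoin_map, IntermediateField.adjoin_le_iff]
  rintro _ ⟨c, ⟨x, y, h, hm, hc⟩, rfl⟩
  obtain ⟨h', e⟩ := pointAction_some σ h
  refine IntermediateField.subset_adjoin _ _ ⟨σ x, σ y, h', ?_, ?_⟩
  · rw [← e, ← map_nsmul]
    convert map_zero (W.pointAction Ω σ)
  · rcases hc with rfl | rfl
    exacts [.inl rfl, .inr rfl]

namespace ThreeTorsionFrame

variable {x : Fin 4 → Ω} (f : ThreeTorsionFrame W x)

theorem mem_fixingSubgroup_iff (g : Ω ≃ₐ[K] Ω) :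
    g ∈ (W.torsionField Ω 3).fixingSubgroup ↔ f.ρ g = 1 := by
  classical
  rw [IntermediateField.mem_fixingSubgroup_iff]
  constructor
  · intro h
    have hfix (v : Fin 2 → ZMod 3) : (f.ρ g).1 *ᵥ v = v := by
      apply f.comb_injective
      rw [← f.pointAction_comb]
      have h3 := f.three_nsmul_comb v
      rcases hv : zmodThreeComb f.P f.Q v with _ | ⟨a, b, hab⟩
      · exact map_zero (W.pointAction Ω g)
      · rw [hv] at h3
        obtain ⟨h', e⟩ := pointAction_some g hab
        rw [e, Affine.Point.some.injEq]
        exact ⟨h a (IntermediateField.subset_adjoin _ _ ⟨a, b, hab, by convert h3, .inl rfl⟩),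
          h b (IntermediateField.subset_adjoin _ _ ⟨a, b, hab, by convert h3, .inr rfl⟩)⟩
    refine Units.ext (Matrix.ext_of_mulVec_single fun i => ?_)
    rw [hfix, Units.val_one, one_mulVec]
  · intro h c hc
    induction hc using IntermediateField.adjoin_induction with
    | mem z hz =>
      obtain ⟨a, b, hab, h3, hz⟩ := hz
      obtain ⟨v, hv⟩ := f.exists_eq_comb (.some a b hab) (by convert h3)
      have hact := f.pointAction_comb g v
      obtain ⟨h', e⟩ := pointAction_some g hab
      rw [h, Units.val_one, one_mulVec, ← hv, e, Affine.Point.some.injEq] at hact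
      rcases hz with rfl | rfl
      exacts [hact.1, hact.2]
    | algebraMap z => exact g.commutes z
    | add _ _ _ _ h₁ h₂ => rw [map_add, h₁, h₂]
    | inv _ _ h => rw [map_inv₀, h]
    | mul _ _ _ _ h₁ h₂ => rw [map_mul, h₁, h₂]

/-- Restriction to the torsion field is surjective and has the same kernel as `ρ`. -/
theorem nonempty_torsionGal_mulEquiv [Normal K Ω] :
    Nonempty (W.TorsionGal Ω 3 ≃* f.ρ.range) := by
  have := W.normal_torsionField (Ω := Ω) 3
  have hker : (AlgEquiv.restrictNormalHom (F := K) (K₁ := Ω) (W.torsionField Ω 3)).ker =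
      f.ρ.ker := by
    ext g
    rw [IntermediateField.restrictNormalHom_ker, f.mem_fixingSubgroup_iff, MonoidHom.mem_ker]
  exact ⟨((QuotientGroup.quotientKerEquivOfSurjective _
    (AlgEquiv.restrictNormalHom_surjective Ω)).symm.trans
      (QuotientGroup.quotientMulEquivOfEq hker)).trans (QuotientGroup.quotientKerEquivRange f.ρ)⟩

end ThreeTorsionFrame

/-! ### Separability of the `3`-torsion -/

theorem separable_Ψ₃ [IsAlgClosed Ω] (h3 : (3 : Ω) ≠ 0) (h : (W.Ψ₃.aroots Ω).Nodup) :
    W.Ψ₃.Separable := by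
  have h3K : (3 : K) ≠ 0 := fun h => h3 (by rw [← map_ofNat (algebraMap K Ω), h, map_zero])
  exact (Polynomial.nodup_aroots_iff_of_splits (W.Ψ₃_ne_zero h3K) (IsAlgClosed.splits _)).1 h

theorem isSeparable_of_aeval_Ψ₃ (h : W.Ψ₃.Separable) {z : Ω} (hz : Polynomial.aeval z W.Ψ₃ = 0) :
    IsSeparable K z :=
  h.of_dvd (minpoly.dvd _ _ hz)

/-- The ordinate is a root of a quadratic whose derivative there, `2y + a₁z + a₃`, is nonzero
because a point of order three is not of order two. -/
theorem isSeparable_of_equation [W.IsElliptic] {z y : Ω} (hz : IsSeparable K z)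
    (hψ : Polynomial.aeval z W.Ψ₃ = 0) (h : (W⁄Ω).toAffine.Equation z y) : IsSeparable K y := by
  have hd := (W⁄Ω).two_mul_add_ne_zero_of_eval_Ψ₃ h ((eval_Ψ₃_baseChange z).trans hψ)
  have hE := (Affine.equation_iff _ _).1 h
  have hz' := mem_separableClosure_iff.2 hz
  have ha (a : K) : algebraMap K Ω a ∈ separableClosure K Ω := algebraMap_mem _ a
  refine isSeparable_of_quadratic (b := (W⁄Ω).a₁ * z + (W⁄Ω).a₃)
    (c := -(z ^ 3 + (W⁄Ω).a₂ * z ^ 2 + (W⁄Ω).a₄ * z + (W⁄Ω).a₆))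
    (mem_separableClosure_iff.1 ?_) (mem_separableClosure_iff.1 ?_) ?_ ?_
  · exact add_mem (mul_mem (ha _) hz') (ha _)
  · exact neg_mem (add_mem (add_mem (add_mem (pow_mem hz' 3) (mul_mem (ha _) (pow_mem hz' 2)))
      (mul_mem (ha _) hz')) (ha _))
  · linear_combination hE
  · rwa [← add_assoc]

/-- If the reduction is additive and the discriminant is a cube, then no nonzero `3`-torsion point
is rational. -/
theorem ThreeTorsionFrame.not_exists_fixed [IsAlgClosure K Ω] [W.IsElliptic] {x : Fin 4 → Ω}
    (f : ThreeTorsionFrame W x) (hsep : W.Ψ₃.Separable) {R : Type*} [CommRing R] [IsDomain R]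
    [IsDiscreteValuationRing R] [Algebra R K] [IsFractionRing R K]
    (hadd : W.HasAdditiveReduction R) (h3 : IsUnit (3 : R)) {d : K} (hd : d ^ 3 = W.Δ) :
    ¬ ∃ v : Fin 2 → ZMod 3, v ≠ 0 ∧ ∀ g ∈ f.ρ.range, g.1 *ᵥ v = v := by
  classical
  rintro ⟨v, hv, hfix⟩
  have h3v := f.three_nsmul_comb v
  rcases hR : zmodThreeComb f.P f.Q v with _ | ⟨a, b, hab⟩
  · refine hv (f.comb_injective (hR.trans ?_))
    change 0 = _
    simp [zmodThreeComb]
  · rw [hR] at h3v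
    have hψ : Polynomial.aeval a W.Ψ₃ = 0 := by
      rw [← eval_Ψ₃_baseChange]
      exact ((W⁄Ω).three_nsmul_eq_zero_iff hab).1 (by convert h3v)
    have hg (g : Ω ≃ₐ[K] Ω) : g a = a ∧ g b = b := by
      have hact := f.pointAction_comb g v
      obtain ⟨h', e⟩ := pointAction_some g hab
      rwa [hfix _ ⟨g, rfl⟩, hR, e, Affine.Point.some.injEq] at hact
    have ha := isSeparable_of_aeval_Ψ₃ hsep hψ
    have hb := isSeparable_of_equation ha hψ hab.1
    -- The coordinates of a fixed point are separable and fixed by every automorphism, so they lie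
    -- in `K`.
    have hbot {z : Ω} (hz : IsSeparable K z) (h : ∀ g : Ω ≃ₐ[K] Ω, g z = z) :
        ∃ c, algebraMap K Ω c = z := by
      rw [← Set.mem_range, ← IntermediateField.mem_bot, ← IntermediateField.adjoin_empty,
        mem_adjoin_iff_forall_fixed hz]
      exact fun g _ => h g
    obtain ⟨a, rfl⟩ := hbot ha fun g => (hg g).1
    obtain ⟨b, rfl⟩ := hbot hb fun g => (hg g).2
    have hinj := (algebraMap K Ω).injective
    refine hadd.not_isCube_Δ W h3 (x := a) (y := b)
      ((Affine.map_equation W.toAffine hinj a b).1 hab.1) ?_ d hd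
    rw [Polynomial.aeval_algebraMap_apply, map_eq_zero_iff _ hinj] at hψ
    simpa using hψ

end WeierstrassCurve

section Descent

variable {K Ω : Type*} [Field K] [Field Ω] [Algebra K Ω] [IsAlgClosure K Ω]

theorem mem_bot_iff_forall_fixed {x : Ω} (hx : IsSeparable K x) :
    x ∈ (⊥ : IntermediateField K Ω) ↔ ∀ g : Ω ≃ₐ[K] Ω, g x = x := by
  rw [← IntermediateField.adjoin_empty, mem_adjoin_iff_forall_fixed hx]
  simp

theorem exists_of_adjoin_ne {S T : Set Ω} (hST : S ⊆ T) (hT : ∀ z ∈ T, IsSeparable K z)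
    (hne : IntermediateField.adjoin K T ≠ IntermediateField.adjoin K S) :
    ∃ g : Ω ≃ₐ[K] Ω, (∀ z ∈ S, g z = z) ∧ ∃ z ∈ T, g z ≠ z := by
  by_contra! h
  refine hne (le_antisymm (IntermediateField.adjoin_le_iff.2 fun z hz => ?_)
    (IntermediateField.adjoin.mono K S T hST))
  exact (mem_adjoin_iff_forall_fixed (hT z hz)).2 fun g hg => h g hg z hz

end Descent

/-! ### The four cases, deduced from the matrix dictionary. -/

namespace WeierstrassCurve

open Matrix GLTwoThree

/-- The Galois representation on the `3`-torsion, together with the translation of the action on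
`α, β, s, t, δ, ζ` into properties of matrices. -/
structure ThreeTorsionData {K : Type*} [Field K] (W : WeierstrassCurve K) {Ω : Type*} [Field Ω]
    [Algebra K Ω] (α β s t δ ζ : Ω) where
  /-- the Galois representation -/
  ρ : (Ω ≃ₐ[K] Ω) →* GL (Fin 2) (ZMod 3)
  nonempty_mulEquiv : Nonempty (W.TorsionGal Ω 3 ≃* ρ.range)
  apply_α_iff : ∀ g, g α = α ↔ ρ g 1 0 = 0
  apply_αβ_iff : ∀ g, g α = α ∧ g β = β ↔ ρ g 0 0 = 1 ∧ ρ g 1 0 = 0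
  apply_st_iff : ∀ g, g s = s ∧ g t = t ↔ Monomial (ρ g)
  apply_δ_iff : ∀ g, g δ = δ ↔ Paired (ρ g)
  apply_ζ_iff : ∀ g, g ζ = ζ ↔ (ρ g).1.det = 1
  isSeparable_α : IsSeparable K α
  isSeparable_β : IsSeparable K β
  isSeparable_s : IsSeparable K s
  isSeparable_t : IsSeparable K t
  isSeparable_δ : IsSeparable K δ
  isSeparable_ζ : IsSeparable K ζ
  -- These last two fields carry the arithmetic of `K`; all the others translate the action on
  -- generators.
  not_exists_fixed : δ ∈ (⊥ : IntermediateField K Ω) →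
    ¬ ∃ v : Fin 2 → ZMod 3, v ≠ 0 ∧ ∀ m ∈ ρ.range, m.1 *ᵥ v = v
  exists_apply_δ_ne : δ ∉ (⊥ : IntermediateField K Ω) →
    ∃ g : Ω ≃ₐ[K] Ω, g ζ = ζ ∧ g δ ≠ δ

namespace ThreeTorsionData

variable {K : Type*} [Field K] {W : WeierstrassCurve K} {Ω : Type*} [Field Ω]
    [Algebra K Ω] {α β s t δ ζ : Ω}

theorem nonempty_of_range (D : ThreeTorsionData W α β s t δ ζ) {G : Type*} [Group G]
    (h : Nonempty (D.ρ.range ≃* G)) :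
    Nonempty (W.TorsionGal Ω 3 ≃* G) := by
  obtain ⟨e⟩ := D.nonempty_mulEquiv
  obtain ⟨e'⟩ := h
  exact ⟨e.trans e'⟩

theorem exists_not_paired (D : ThreeTorsionData W α β s t δ ζ)
    (h : δ ∉ (⊥ : IntermediateField K Ω)) :
    ∃ m ∈ D.ρ.range, m.1.det = 1 ∧ ¬ Paired m := by
  obtain ⟨g, hg, hg'⟩ := D.exists_apply_δ_ne h
  exact ⟨_, ⟨g, rfl⟩, (D.apply_ζ_iff g).1 hg, mt (D.apply_δ_iff g).2 hg'⟩

/-- An automorphism fixing `δ`, `ζ` and `α` is represented by `1` or `-1`. -/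
theorem eq_one_or (D : ThreeTorsionData W α β s t δ ζ) {g : Ω ≃ₐ[K] Ω} (hQ : Quat (D.ρ g))
    (hα : g α = α) :
    D.ρ g = 1 ∨ D.ρ g = -1 :=
  hQ.eq_one_or ((D.apply_α_iff g).1 hα)

theorem eq_one (D : ThreeTorsionData W α β s t δ ζ) {g : Ω ≃ₐ[K] Ω} (hQ : Quat (D.ρ g))
    (hα : g α = α) (hβ : g β = β) :
    D.ρ g = 1 := by
  refine (D.eq_one_or hQ hα).resolve_right fun h => ?_
  have h1 := ((D.apply_αβ_iff g).1 ⟨hα, hβ⟩).1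
  rw [h] at h1
  revert h1
  decide

theorem eq_neg_one (D : ThreeTorsionData W α β s t δ ζ) {g : Ω ≃ₐ[K] Ω} (hQ : Quat (D.ρ g))
    (hα : g α = α) (hβ : g β ≠ β) :
    D.ρ g = -1 := by
  refine (D.eq_one_or hQ hα).resolve_left fun h => hβ ?_
  refine ((D.apply_αβ_iff g).2 ?_).2
  rw [h]
  decide

theorem monomial_of_apply_α (D : ThreeTorsionData W α β s t δ ζ) {g : Ω ≃ₐ[K] Ω} (hQ : Quat (D.ρ g))
    (hα : g α = α) :
    Monomial (D.ρ g) := by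
  rcases D.eq_one_or hQ hα with h | h <;> rw [h] <;> exact .inl (by decide)

variable [IsAlgClosure K Ω]

theorem forall_det (D : ThreeTorsionData W α β s t δ ζ) (h : ζ ∈ (⊥ : IntermediateField K Ω)) :
    ∀ m ∈ D.ρ.range, m.1.det = 1 := by
  rintro _ ⟨g, rfl⟩
  exact (D.apply_ζ_iff g).1 ((mem_bot_iff_forall_fixed D.isSeparable_ζ).1 h g)

theorem exists_det (D : ThreeTorsionData W α β s t δ ζ) (h : ζ ∉ (⊥ : IntermediateField K Ω)) :
    ∃ m ∈ D.ρ.range, m.1.det = -1 := by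
  rw [mem_bot_iff_forall_fixed D.isSeparable_ζ] at h
  obtain ⟨g, hg⟩ := not_forall.1 h
  exact ⟨_, ⟨g, rfl⟩, (det_eq_one_or _).resolve_left (mt (D.apply_ζ_iff g).2 hg)⟩

theorem forall_paired (D : ThreeTorsionData W α β s t δ ζ) (h : δ ∈ (⊥ : IntermediateField K Ω)) :
    ∀ m ∈ D.ρ.range, Paired m := by
  rintro _ ⟨g, rfl⟩
  exact (D.apply_δ_iff g).1 ((mem_bot_iff_forall_fixed D.isSeparable_δ).1 h g)

/-- If adjoining `s` and `t` to `K(S)` gives a larger field, then some automorphism over `K(S)` is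
not represented by a monomial matrix. -/
theorem exists_not_monomial (D : ThreeTorsionData W α β s t δ ζ) {S T : Set Ω} (hT : T = S ∪ {s, t})
    (hS : ∀ z ∈ S, IsSeparable K z)
    (hne : IntermediateField.adjoin K T ≠ IntermediateField.adjoin K S) :
    ∃ g : Ω ≃ₐ[K] Ω, (∀ z ∈ S, g z = z) ∧ ¬ Monomial (D.ρ g) := by
  subst hT
  obtain ⟨g, hg, z, hz, hgz⟩ := exists_of_adjoin_ne Set.subset_union_left (fun z hz => by
    rcases hz with hz | rfl | rfl
    exacts [hS z hz, D.isSeparable_s, D.isSeparable_t]) hne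
  refine ⟨g, hg, fun h => ?_⟩
  obtain ⟨h₁, h₂⟩ := (D.apply_st_iff g).2 h
  rcases hz with hz | rfl | rfl
  exacts [hgz (hg z hz), hgz h₁, hgz h₂]

theorem exists_not_monomial_of_ne_bot (D : ThreeTorsionData W α β s t δ ζ) (hne : K⟮s, t⟯ ≠ ⊥) :
    ∃ m ∈ D.ρ.range, ¬ Monomial m := by
  rw [← IntermediateField.adjoin_empty] at hne
  obtain ⟨g, -, hg⟩ := D.exists_not_monomial (by simp) (by simp) hne
  exact ⟨_, ⟨g, rfl⟩, hg⟩

theorem exists_not_monomial_ζ (D : ThreeTorsionData W α β s t δ ζ) (hne : K⟮ζ, s, t⟯ ≠ K⟮ζ⟯) :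
    ∃ m ∈ D.ρ.range, m.1.det = 1 ∧ ¬ Monomial m := by
  obtain ⟨g, hg, hg'⟩ := D.exists_not_monomial (S := {ζ}) rfl (by simp [D.isSeparable_ζ]) hne
  exact ⟨_, ⟨g, rfl⟩, (D.apply_ζ_iff g).1 (hg ζ rfl), hg'⟩

/-- Here `H` lies in the quaternion group, and its size depends on which of its elements are
monomial or preserve the first axis. -/
theorem torsionGal_of_mem_mem (D : ThreeTorsionData W α β s t δ ζ)
    (hζ : ζ ∈ (⊥ : IntermediateField K Ω))
    (hδ : δ ∈ (⊥ : IntermediateField K Ω)) :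
    (α ∈ (⊥ : IntermediateField K Ω) →
      Nonempty (W.TorsionGal Ω 3 ≃* Multiplicative (ZMod 2))) ∧
    (α ∉ (⊥ : IntermediateField K Ω) → s ∈ (⊥ : IntermediateField K Ω) →
      t ∈ (⊥ : IntermediateField K Ω) →
      Nonempty (W.TorsionGal Ω 3 ≃* Multiplicative (ZMod 4))) ∧
    (K⟮s, t⟯ ≠ ⊥ → α ∈ K⟮s, t⟯ →
      Nonempty (W.TorsionGal Ω 3 ≃* Multiplicative (ZMod 4))) ∧
    (K⟮s, t⟯ ≠ ⊥ → α ∉ K⟮s, t⟯ →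
      Nonempty (W.TorsionGal Ω 3 ≃* QuaternionGroup 2)) := by
  have hQ (m) (hm : m ∈ D.ρ.range) : Quat m := ⟨D.forall_det hζ m hm, D.forall_paired hδ m hm⟩
  refine ⟨fun hα => ?_, fun hα hs ht => ?_, fun hne hα => ?_, fun hne hα => ?_⟩
  · rw [mem_bot_iff_forall_fixed D.isSeparable_α] at hα
    refine D.nonempty_of_range (nonempty_mulEquiv_zmod_two ?_ ?_)
    · rintro _ ⟨g, rfl⟩
      exact (hQ _ ⟨g, rfl⟩).eq_one_or ((D.apply_α_iff g).1 (hα g))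
    -- A trivial image would make every `3`-torsion point rational.
    · by_contra! h
      refine D.not_exists_fixed hδ ⟨![1, 0], by decide, fun m hm => ?_⟩
      rw [h m hm, Units.val_one, one_mulVec]
  · rw [mem_bot_iff_forall_fixed D.isSeparable_α] at hα
    rw [mem_bot_iff_forall_fixed D.isSeparable_s] at hs
    rw [mem_bot_iff_forall_fixed D.isSeparable_t] at ht
    refine D.nonempty_of_range (nonempty_mulEquiv_zmod_four_of_monomial hQ ?_ ?_)
    · rintro _ ⟨g, rfl⟩
      exact (D.apply_st_iff g).1 ⟨hs g, ht g⟩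
    · obtain ⟨g, hg⟩ := not_forall.1 hα
      exact ⟨_, ⟨g, rfl⟩, mt (D.apply_α_iff g).2 hg⟩
  · rw [mem_adjoin_iff_forall_fixed D.isSeparable_α] at hα
    refine D.nonempty_of_range (nonempty_mulEquiv_zmod_four_of_not_monomial hQ ?_
      (D.exists_not_monomial_of_ne_bot hne))
    rintro _ ⟨g, rfl⟩ hg
    refine (D.apply_α_iff g).1 (hα g ?_)
    simpa using (D.apply_st_iff g).2 hg
  · rw [mem_adjoin_iff_forall_fixed D.isSeparable_α] at hα
    refine D.nonempty_of_range (nonempty_mulEquiv_quaternionGroup hQ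
      (D.exists_not_monomial_of_ne_bot hne) ?_)
    push Not at hα
    obtain ⟨g, hg, hg'⟩ := hα
    exact ⟨_, ⟨g, rfl⟩, (D.apply_st_iff g).1 (by simpa using hg), mt (D.apply_α_iff g).2 hg'⟩

/-- Here `H` lies in `SL₂(𝔽₃)` but not in its quaternion subgroup, so only the intersection with the
latter remains to be found: trivial, `±1`, or large enough to give everything. -/
theorem torsionGal_of_mem_notMem (D : ThreeTorsionData W α β s t δ ζ)
    (hζ : ζ ∈ (⊥ : IntermediateField K Ω))
    (hδ : δ ∉ (⊥ : IntermediateField K Ω)) :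
    (α ∈ K⟮δ⟯ → β ∈ K⟮δ⟯ → Nonempty (W.TorsionGal Ω 3 ≃* Multiplicative (ZMod 3))) ∧
    (α ∈ K⟮δ⟯ → β ∉ K⟮δ⟯ → Nonempty (W.TorsionGal Ω 3 ≃* Multiplicative (ZMod 6))) ∧
    (K⟮δ, s, t⟯ ≠ K⟮δ⟯ →
      Nonempty (W.TorsionGal Ω 3 ≃* Matrix.SpecialLinearGroup (Fin 2) (ZMod 3))) := by
  have hdet := D.forall_det hζ
  have hnp : ∃ m ∈ D.ρ.range, ¬ Paired m := by
    obtain ⟨m, hm, -, hm'⟩ := D.exists_not_paired hδ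
    exact ⟨m, hm, hm'⟩
  have hQ {g : Ω ≃ₐ[K] Ω} (hg : Paired (D.ρ g)) : Quat (D.ρ g) := ⟨hdet _ ⟨g, rfl⟩, hg⟩
  refine ⟨fun hα hβ => ?_, fun hα hβ => ?_, fun hne => ?_⟩
  · rw [mem_adjoin_iff_forall_fixed D.isSeparable_α] at hα
    rw [mem_adjoin_iff_forall_fixed D.isSeparable_β] at hβ
    refine D.nonempty_of_range (nonempty_mulEquiv_zmod_three hdet hnp ?_)
    rintro _ ⟨g, rfl⟩ hg
    have hg' : ∀ z ∈ ({δ} : Set Ω), g z = z := by simpa using (D.apply_δ_iff g).2 hg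
    exact D.eq_one (hQ hg) (hα g hg') (hβ g hg')
  · rw [mem_adjoin_iff_forall_fixed D.isSeparable_α] at hα
    rw [mem_adjoin_iff_forall_fixed D.isSeparable_β] at hβ
    refine D.nonempty_of_range (nonempty_mulEquiv_zmod_six hdet hnp ?_ ?_)
    · rintro _ ⟨g, rfl⟩ hg
      exact D.eq_one_or (hQ hg) (hα g (by simpa using (D.apply_δ_iff g).2 hg))
    · push Not at hβ
      obtain ⟨g, hg, hg'⟩ := hβ
      exact ⟨g, D.eq_neg_one (hQ ((D.apply_δ_iff g).1 (hg δ rfl))) (hα g hg) hg'⟩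
  · obtain ⟨g, hg, hg'⟩ := D.exists_not_monomial (S := {δ}) rfl (by simp [D.isSeparable_δ]) hne
    exact D.nonempty_of_range (nonempty_mulEquiv_specialLinearGroup hdet hnp
      ⟨_, ⟨g, rfl⟩, (D.apply_δ_iff g).1 (hg δ rfl), hg'⟩)

/-- Here `H` lies in the Sylow `2`-subgroup of paired matrices and is not contained in `SL₂(𝔽₃)`. -/
theorem torsionGal_of_notMem_mem (D : ThreeTorsionData W α β s t δ ζ)
    (hζ : ζ ∉ (⊥ : IntermediateField K Ω))
    (hδ : δ ∈ (⊥ : IntermediateField K Ω)) :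
    (α ∈ K⟮ζ⟯ →
      Nonempty (W.TorsionGal Ω 3 ≃* Multiplicative (ZMod 2) × Multiplicative (ZMod 2))) ∧
    (α ∉ K⟮ζ⟯ → s ∈ K⟮ζ⟯ → t ∈ K⟮ζ⟯ → K⟮s, t⟯ ≠ ⊥ →
      Nonempty (W.TorsionGal Ω 3 ≃* Multiplicative (ZMod 8))) ∧
    (α ∉ K⟮ζ⟯ → s ∈ (⊥ : IntermediateField K Ω) → t ∈ (⊥ : IntermediateField K Ω) →
      Nonempty (W.TorsionGal Ω 3 ≃* DihedralGroup 4)) ∧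
    (K⟮ζ, s, t⟯ ≠ K⟮ζ⟯ → α ∈ K⟮ζ, s, t⟯ →
      Nonempty (W.TorsionGal Ω 3 ≃* DihedralGroup 4)) ∧
    (K⟮ζ, s, t⟯ ≠ K⟮ζ⟯ →
      α ∉ K⟮ζ⟯ ∧ Nonempty (W.TorsionGal Ω 3 ≃* SemidihedralGroup16)) := by
  have hdet := D.exists_det hζ
  have hp := D.forall_paired hδ
  have hfix {g : Ω ≃ₐ[K] Ω} (hg : (D.ρ g).1.det = 1) : ∀ z ∈ ({ζ} : Set Ω), g z = z := by
    simpa using (D.apply_ζ_iff g).2 hg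
  refine ⟨fun hα => ?_, fun _ hs ht hne => ?_, fun hα hs ht => ?_, fun hne hα => ?_,
    fun hne => ⟨fun hα => ?_, ?_⟩⟩
  · rw [mem_adjoin_iff_forall_fixed D.isSeparable_α] at hα
    refine D.nonempty_of_range (nonempty_mulEquiv_zmod_two_prod hdet hp ?_ (D.not_exists_fixed hδ))
    rintro _ ⟨g, rfl⟩ hg
    exact (D.apply_α_iff g).1 (hα g (hfix hg))
  · rw [mem_adjoin_iff_forall_fixed D.isSeparable_s] at hs
    rw [mem_adjoin_iff_forall_fixed D.isSeparable_t] at ht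
    refine D.nonempty_of_range (nonempty_mulEquiv_zmod_eight hp ?_
      (D.exists_not_monomial_of_ne_bot hne))
    rintro _ ⟨g, rfl⟩ hg
    exact (D.apply_st_iff g).1 ⟨hs g (hfix hg), ht g (hfix hg)⟩
  · rw [mem_adjoin_iff_forall_fixed D.isSeparable_α] at hα
    rw [mem_bot_iff_forall_fixed D.isSeparable_s] at hs
    rw [mem_bot_iff_forall_fixed D.isSeparable_t] at ht
    refine D.nonempty_of_range (nonempty_mulEquiv_dihedralGroup_four hdet ?_ ?_)
    · rintro _ ⟨g, rfl⟩
      exact (D.apply_st_iff g).1 ⟨hs g, ht g⟩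
    · push Not at hα
      obtain ⟨g, hg, hg'⟩ := hα
      exact ⟨_, ⟨g, rfl⟩, (D.apply_ζ_iff g).1 (hg ζ rfl), mt (D.apply_α_iff g).2 hg'⟩
  · rw [mem_adjoin_iff_forall_fixed D.isSeparable_α] at hα
    -- The hypotheses are contradictory: `H` contains all paired matrices, in particular this one,
    -- which fixes `ζ`, `s` and `t` but exchanges the axes and so moves `α`.
    let z : GL (Fin 2) (ZMod 3) := ⟨!![0, 1; 2, 0], !![0, 2; 1, 0], by decide, by decide⟩
    have hzm : Monomial z := .inr (by decide)
    obtain ⟨g, hg⟩ := mem_of_paired hdet hp (D.exists_not_monomial_ζ hne) hzm.paired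
    have hz : z 1 0 = 0 := by
      rw [← hg, ← D.apply_α_iff]
      refine hα g ?_
      have h₁ : g ζ = ζ := (D.apply_ζ_iff g).2 (by rw [hg]; decide)
      simpa [h₁] using (D.apply_st_iff g).2 (by rwa [hg])
    exact absurd hz (by decide)
  · rw [mem_adjoin_iff_forall_fixed D.isSeparable_α] at hα
    obtain ⟨_, ⟨g, rfl⟩, hg, hg'⟩ := D.exists_not_monomial_ζ hne
    -- Over `K(ζ)` an automorphism fixing `α` acts as `±1`, hence fixes `s` and `t`.
    exact hg' (D.monomial_of_apply_α ⟨hg, hp _ ⟨g, rfl⟩⟩ (hα g (hfix hg)))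
  · exact D.nonempty_of_range
      (nonempty_mulEquiv_semidihedralGroup16 hdet hp (D.exists_not_monomial_ζ hne))

theorem torsionGal_of_notMem_notMem (D : ThreeTorsionData W α β s t δ ζ)
    (hζ : ζ ∉ (⊥ : IntermediateField K Ω))
    (hδ : δ ∉ (⊥ : IntermediateField K Ω)) :
    (α ∈ K⟮δ, ζ⟯ → β ∈ K⟮δ, ζ⟯ → Nonempty (W.TorsionGal Ω 3 ≃* DihedralGroup 3)) ∧
    (α ∈ K⟮δ, ζ⟯ → β ∉ K⟮δ, ζ⟯ → Nonempty (W.TorsionGal Ω 3 ≃* DihedralGroup 6)) ∧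
    (K⟮δ, ζ, s, t⟯ ≠ K⟮δ, ζ⟯ → α ∉ K⟮δ, ζ⟯ ∧
      Nonempty (W.TorsionGal Ω 3 ≃* Matrix.GeneralLinearGroup (Fin 2) (ZMod 3))) := by
  have hdet := D.exists_det hζ
  have hnp := D.exists_not_paired hδ
  have hQ (g : Ω ≃ₐ[K] Ω) : (∀ z ∈ ({δ, ζ} : Set Ω), g z = z) ↔ Quat (D.ρ g) := by
    simp [Quat, D.apply_δ_iff, D.apply_ζ_iff, and_comm]
  refine ⟨fun hα hβ => ?_, fun hα hβ => ?_, fun hne => ?_⟩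
  · rw [mem_adjoin_iff_forall_fixed D.isSeparable_α] at hα
    rw [mem_adjoin_iff_forall_fixed D.isSeparable_β] at hβ
    refine D.nonempty_of_range (nonempty_mulEquiv_dihedralGroup_three hdet hnp ?_)
    rintro _ ⟨g, rfl⟩ hg
    exact D.eq_one hg (hα g ((hQ g).2 hg)) (hβ g ((hQ g).2 hg))
  · rw [mem_adjoin_iff_forall_fixed D.isSeparable_α] at hα
    rw [mem_adjoin_iff_forall_fixed D.isSeparable_β] at hβ
    refine D.nonempty_of_range (nonempty_mulEquiv_dihedralGroup_six hdet hnp ?_ ?_)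
    · rintro _ ⟨g, rfl⟩ hg
      exact D.eq_one_or hg (hα g ((hQ g).2 hg))
    · push Not at hβ
      obtain ⟨g, hg, hg'⟩ := hβ
      exact ⟨g, D.eq_neg_one ((hQ g).1 hg) (hα g hg) hg'⟩
  · obtain ⟨g, hg, hg'⟩ := D.exists_not_monomial (S := {δ, ζ})
        (by rw [Set.insert_union, Set.singleton_union])
      (by simp [D.isSeparable_δ, D.isSeparable_ζ]) hne
    refine ⟨fun hα => ?_, D.nonempty_of_range (nonempty_mulEquiv_generalLinearGroup hdet hnp
      ⟨_, ⟨g, rfl⟩, (hQ g).1 hg, hg'⟩)⟩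
    rw [mem_adjoin_iff_forall_fixed D.isSeparable_α] at hα
    exact hg' (D.monomial_of_apply_α ((hQ g).1 hg) (hα g hg))

end ThreeTorsionData

end WeierstrassCurve

/-! ### Construction of the dictionary for the given curve. -/

namespace WeierstrassCurve

open Matrix GLTwoThree

/-- If every automorphism fixing a primitive cube root of unity `ζ` fixes `δ`, then some cube root
of `δ ^ 3` is fixed by all automorphisms. -/
theorem exists_pow_three_eq_forall_fixed {K Ω : Type*} [Field K] [Field Ω] [Algebra K Ω] {δ ζ : Ω}
    (hζ : ζ ^ 2 + ζ + 1 = 0) {a : K} (hδ : δ ^ 3 = algebraMap K Ω a)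
    (h : ∀ g : Ω ≃ₐ[K] Ω, g ζ = ζ → g δ = δ) :
    ∃ i : ℕ, ∀ g : Ω ≃ₐ[K] Ω, g (ζ ^ i * δ) = ζ ^ i * δ := by
  have hζ3 : ζ ^ 3 = 1 := by linear_combination (ζ - 1) * hζ
  by_cases hall : ∀ g : Ω ≃ₐ[K] Ω, g ζ = ζ
  · exact ⟨0, fun g => by simpa using h g (hall g)⟩
  push Not at hall
  obtain ⟨τ, hτ⟩ := hall
  have hconj (g : Ω ≃ₐ[K] Ω) (hg : g ζ ≠ ζ) : g ζ = ζ ^ 2 := by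
    have h1 : g ζ ^ 2 + g ζ + 1 = 0 := by
      rw [← map_pow, ← map_add, ← map_one g, ← map_add, hζ, map_zero]
    have h2 : (g ζ - ζ) * (g ζ - ζ ^ 2) = 0 := by linear_combination h1 + (ζ - 1 - g ζ) * hζ
    exact sub_eq_zero.1 ((mul_eq_zero.1 h2).resolve_left (sub_ne_zero.2 hg))
  obtain ⟨k, hk⟩ : ∃ k : ℕ, τ δ = ζ ^ k * δ := by
    have h1 : τ δ ^ 3 = δ ^ 3 := by rw [← map_pow, hδ, τ.commutes]
    have h2 : (τ δ - δ) * ((τ δ - ζ * δ) * (τ δ - ζ ^ 2 * δ)) = 0 := by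
      linear_combination h1 + (-τ δ ^ 2 * δ + τ δ * δ ^ 2 * ζ - δ ^ 3 * (ζ - 1)) * hζ
    rcases mul_eq_zero.1 h2 with h | h
    · exact ⟨0, by linear_combination h⟩
    rcases mul_eq_zero.1 h with h | h
    · exact ⟨1, by linear_combination h⟩
    · exact ⟨2, by linear_combination h⟩
  -- As `τ ζ = ζ²`, `τ` sends `ζ ^ j * δ` to `ζ ^ (2j + k) * δ`; it is fixed when `j ≡ -k ≡ 2k`
  -- modulo `3`. Any other automorphism moving `ζ` differs from `τ` by one fixing `ζ`.
  have hττ : τ (ζ ^ (2 * k) * δ) = ζ ^ (2 * k) * δ := by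
    rw [map_mul, map_pow, hconj τ hτ, hk, ← mul_assoc, ← pow_mul, ← pow_add,
      show 2 * (2 * k) + k = 3 * k + 2 * k by ring, pow_add, pow_mul, hζ3, one_pow, one_mul]
  refine ⟨2 * k, fun g => ?_⟩
  by_cases hg : g ζ = ζ
  · rw [map_mul, map_pow, hg, h g hg]
  · have hτg : (τ⁻¹ * g) ζ = ζ := by
      change τ.symm (g ζ) = ζ
      rw [hconj g hg, ← hconj τ hτ, τ.symm_apply_apply]
    have hfix : (τ⁻¹ * g) (ζ ^ (2 * k) * δ) = ζ ^ (2 * k) * δ := by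
      rw [map_mul, map_pow, hτg, h _ hτg]
    have : g = τ * (τ⁻¹ * g) := by group
    rw [this]
    exact (congrArg τ hfix).trans hττ

theorem exists_threeTorsionData {K : Type*} [Field K] {Ω : Type*} [Field Ω] [Algebra K Ω]
    [IsAlgClosure K Ω] {W : WeierstrassCurve K} [W.IsElliptic] {R : Type*} [CommRing R]
    [IsDomain R] [IsDiscreteValuationRing R] [Algebra R K] [IsFractionRing R K]
    (hadd : W.HasAdditiveReduction R) (h3 : IsUnit (3 : R)) {x : Fin 4 → Ω}
    (hroots : W.Ψ₃.aroots Ω = {x 0, x 1, x 2, x 3}) {δ : Ω} (hδ : δ ^ 3 = algebraMap K Ω W.Δ)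
    (hδK : (∃ d : K, d ^ 3 = W.Δ) → δ ∈ (⊥ : IntermediateField K Ω))
    (hδx : δ = algebraMap K Ω W.b₄ - 3 * (x 0 * x 1 + x 2 * x 3))
    {ζ : Ω} (hζ : ζ ^ 2 + ζ + 1 = 0) {β : Ω} (hβ : (W⁄Ω).toAffine.Equation (x 0) β) :
    Nonempty (ThreeTorsionData W (x 0) β (x 0 + x 1) (x 0 * x 1) δ ζ) := by
  have : IsAlgClosed Ω := IsAlgClosure.isAlgClosed K
  have : Normal K Ω := IsAlgClosure.normal K Ω
  have h3Ω : (3 : Ω) ≠ 0 := by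
    have h := ((h3.map (algebraMap R K)).map (algebraMap K Ω)).ne_zero
    rwa [map_ofNat, map_ofNat] at h
  have hroots' : (W⁄Ω).Ψ₃.roots = {x 0, x 1, x 2, x 3} := by
    rw [← hroots, Polynomial.aroots, ← map_Ψ₃]
    rfl
  have hb₄ : (W⁄Ω).b₄ = algebraMap K Ω W.b₄ := W.map_b₄ _
  have hδ' : cubicResolvent (algebraMap K Ω W.b₄) x 0 = δ := hδx.symm
  have hΔ : algebraMap K Ω W.Δ ≠ 0 := by simpa using W.isUnit_Δ.ne_zero
  have hδ0 : δ ≠ 0 := by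
    rintro rfl
    exact hΔ (by rw [← hδ]; simp)
  have hD0 : cubicResolvent (algebraMap K Ω W.b₄) x 0 ≠ 0 := hδ' ▸ hδ0
  obtain ⟨ω, hωζ, hω, hstep⟩ := (W⁄Ω).exists_cubicResolvent_eq h3Ω hroots' hζ
  rw [hb₄] at hstep
  have hDinj := cubicResolvent_injective h3Ω hω hstep hD0
  have hxinj := injective_of_cubicResolvent_injective hDinj
  have h3K : (3 : K) ≠ 0 := fun h => h3Ω (by rw [← map_ofNat (algebraMap K Ω), h, map_zero])
  have hroot (z : Ω) : Polynomial.aeval z W.Ψ₃ = 0 ↔ ∃ i, z = x i := by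
    have := Polynomial.mem_aroots (S := Ω) (p := W.Ψ₃) (a := z)
    rw [hroots] at this
    simpa [W.Ψ₃_ne_zero h3K, Fin.exists_fin_succ] using this.symm
  obtain ⟨f, hf⟩ := exists_threeTorsionFrame hxinj
    (fun z => by rw [eval_Ψ₃_baseChange, hroot]) hβ
  have hsep : W.Ψ₃.Separable := by
    refine separable_Ψ₃ h3Ω ?_
    rw [hroots]
    simp [hxinj.eq_iff]
  have hx (i : Fin 4) : x i ∈ separableClosure K Ω :=
    mem_separableClosure_iff.2 (isSeparable_of_aeval_Ψ₃ hsep ((hroot _).2 ⟨i, rfl⟩))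
  have hζsep : IsSeparable K ζ := by
    have h1 : IsSeparable K (1 : Ω) := mem_separableClosure_iff.1 (one_mem _)
    refine isSeparable_of_quadratic h1 h1 (by linear_combination hζ) fun h => h3Ω ?_
    linear_combination 4 * hζ - (2 * ζ + 1) * h
  have hδsep : IsSeparable K δ := by
    rw [← mem_separableClosure_iff, hδx]
    exact sub_mem (algebraMap_mem _ _) (mul_mem (ofNat_mem _ 3)
      (add_mem (mul_mem (hx 0) (hx 1)) (mul_mem (hx 2) (hx 3))))
  have hζ3 : ζ ^ 3 = 1 := by linear_combination (ζ - 1) * hζ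
  -- The numbering of the roots decides whether `ω` is `ζ` or `ζ²`; both are fixed by the same
  -- automorphisms.
  have hζω (g : Ω ≃ₐ[K] Ω) : g ζ = ζ ↔ g ω = ω := by
    rcases hωζ with rfl | rfl
    · rfl
    · refine ⟨fun h => by rw [map_pow, h], fun h => ?_⟩
      have h' := congrArg (· ^ 2) h
      simp only [← map_pow, ← pow_mul] at h'
      rwa [show ζ ^ (2 * 2) = ζ by linear_combination ζ * hζ3] at h'
  have hbot {z : Ω} (hz : z ∈ (⊥ : IntermediateField K Ω)) (hz3 : z ^ 3 = algebraMap K Ω W.Δ) :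
      ∃ d : K, d ^ 3 = W.Δ := by
    obtain ⟨d, rfl⟩ := IntermediateField.mem_bot.1 hz
    exact ⟨d, (algebraMap K Ω).injective (by rw [map_pow, hz3])⟩
  exact ⟨{
    ρ := f.ρ
    nonempty_mulEquiv := f.nonempty_torsionGal_mulEquiv
    apply_α_iff := f.apply_x_zero_eq_iff
    apply_αβ_iff := fun g => f.apply_basis_eq_iff g hf
    apply_st_iff := f.apply_add_mul_eq_iff
    apply_δ_iff := fun g => by rw [← hδ', f.apply_cubicResolvent_zero_eq_iff g hDinj]
    apply_ζ_iff := fun g => by rw [hζω, f.apply_ω_eq_iff g h3Ω hω hstep hD0]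
    isSeparable_α := mem_separableClosure_iff.1 (hx 0)
    isSeparable_β := isSeparable_of_equation (mem_separableClosure_iff.1 (hx 0))
      ((hroot _).2 ⟨0, rfl⟩) hβ
    isSeparable_s := mem_separableClosure_iff.1 (add_mem (hx 0) (hx 1))
    isSeparable_t := mem_separableClosure_iff.1 (mul_mem (hx 0) (hx 1))
    isSeparable_δ := hδsep
    isSeparable_ζ := hζsep
    not_exists_fixed := fun h => by
      obtain ⟨d, hd⟩ := hbot h hδ
      exact f.not_exists_fixed hsep hadd h3 hd
    exists_apply_δ_ne := fun h => by
      by_contra! hall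
      -- Some cube root `ζ ^ i * δ` of `Δ` would lie in `K`, and then `δ` would too by the way it
      -- was chosen.
      obtain ⟨i, hi⟩ := exists_pow_three_eq_forall_fixed hζ hδ hall
      refine h (hδK (hbot (z := ζ ^ i * δ) ((mem_bot_iff_forall_fixed ?_).2 hi) ?_))
      · rw [← mem_separableClosure_iff] at hζsep hδsep ⊢
        exact mul_mem (pow_mem hζsep i) hδsep
      · rw [mul_pow, ← pow_mul, mul_comm i, pow_mul, hζ3, one_pow, one_mul, hδ] }⟩

end WeierstrassCurve

theorem theorem3 {K : Type*} [Field K] [ValuativeRel K] [TopologicalSpace K]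
    [IsNonarchimedeanLocalField K]
    (p : ℕ) [CharP 𝓀[K] p] (hp : p ≠ 3)
    {Ω : Type*} [Field Ω] [Algebra K Ω] [IsAlgClosure K Ω]
    -- a minimal Weierstrass equation of an elliptic curve
    -- with additive, potentially good reduction
    (W : WeierstrassCurve K) [W.IsElliptic]
    (hadd : W.HasAdditiveReduction 𝒪[K]) (hpot : W.HasPotentiallyGoodReduction)
    -- the roots of `Ψ₃ = 3 x ^ 4 + b₂ x ^ 3 + 3 b₄ x ^ 2 + 3 b₆ x + b₈`, with multiplicity
    (α₁ α₂ α₃ α₄ : Ω)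
    (hroots : W.Ψ₃.aroots Ω = {α₁, α₂, α₃, α₄})
    -- the chosen cube root of the discriminant, in `K` if possible
    (δ : Ω) (hδ : δ ^ 3 = algebraMap K Ω W.Δ)
    (hδK : (∃ d : K, d ^ 3 = W.Δ) → δ ∈ (⊥ : IntermediateField K Ω))
    (hδα : δ = algebraMap K Ω W.b₄ - 3 * (α₁ * α₂ + α₃ * α₄))
    (s t : Ω) (hs : s = α₁ + α₂) (ht : t = α₁ * α₂)
    (ζ : Ω) (hζ : IsPrimitiveRoot ζ 3)
    (α β : Ω) (hα : α = α₁) (hβ : (W.baseChange Ω).toAffine.Equation α β) :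
    -- case (1)
    (ζ ∈ (⊥ : IntermediateField K Ω) → δ ∈ (⊥ : IntermediateField K Ω) →
      (α ∈ (⊥ : IntermediateField K Ω) →
        Nonempty (W.TorsionGal Ω 3 ≃* Multiplicative (ZMod 2))) ∧
      (α ∉ (⊥ : IntermediateField K Ω) → s ∈ (⊥ : IntermediateField K Ω) → t ∈ (⊥ : IntermediateField K Ω) →
        Nonempty (W.TorsionGal Ω 3 ≃* Multiplicative (ZMod 4))) ∧
      (K⟮s, t⟯ ≠ ⊥ → α ∈ K⟮s, t⟯ →
        Nonempty (W.TorsionGal Ω 3 ≃* Multiplicative (ZMod 4))) ∧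
      (K⟮s, t⟯ ≠ ⊥ → α ∉ K⟮s, t⟯ →
        Nonempty (W.TorsionGal Ω 3 ≃* QuaternionGroup 2))) ∧
    -- case (2)
    (ζ ∈ (⊥ : IntermediateField K Ω) → δ ∉ (⊥ : IntermediateField K Ω) →
      (α ∈ K⟮δ⟯ → β ∈ K⟮δ⟯ →
        Nonempty (W.TorsionGal Ω 3 ≃* Multiplicative (ZMod 3))) ∧
      (α ∈ K⟮δ⟯ → β ∉ K⟮δ⟯ →
        Nonempty (W.TorsionGal Ω 3 ≃* Multiplicative (ZMod 6))) ∧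
      (K⟮δ, s, t⟯ ≠ K⟮δ⟯ →
        Nonempty (W.TorsionGal Ω 3 ≃* Matrix.SpecialLinearGroup (Fin 2) (ZMod 3)))) ∧
    -- case (3)
    (ζ ∉ (⊥ : IntermediateField K Ω) → δ ∈ (⊥ : IntermediateField K Ω) →
      (α ∈ K⟮ζ⟯ →
        Nonempty (W.TorsionGal Ω 3 ≃* Multiplicative (ZMod 2) × Multiplicative (ZMod 2))) ∧
      (α ∉ K⟮ζ⟯ → s ∈ K⟮ζ⟯ → t ∈ K⟮ζ⟯ → K⟮s, t⟯ ≠ ⊥ →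
        Nonempty (W.TorsionGal Ω 3 ≃* Multiplicative (ZMod 8))) ∧
      (α ∉ K⟮ζ⟯ → s ∈ (⊥ : IntermediateField K Ω) → t ∈ (⊥ : IntermediateField K Ω) →
        Nonempty (W.TorsionGal Ω 3 ≃* DihedralGroup 4)) ∧
      (K⟮ζ, s, t⟯ ≠ K⟮ζ⟯ → α ∈ K⟮ζ, s, t⟯ →
        Nonempty (W.TorsionGal Ω 3 ≃* DihedralGroup 4)) ∧
      (K⟮ζ, s, t⟯ ≠ K⟮ζ⟯ →
        α ∉ K⟮ζ⟯ ∧ Nonempty (W.TorsionGal Ω 3 ≃* SemidihedralGroup16))) ∧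
    -- case (4)
    (ζ ∉ (⊥ : IntermediateField K Ω) → δ ∉ (⊥ : IntermediateField K Ω) →
      (α ∈ K⟮δ, ζ⟯ → β ∈ K⟮δ, ζ⟯ →
        Nonempty (W.TorsionGal Ω 3 ≃* DihedralGroup 3)) ∧
      (α ∈ K⟮δ, ζ⟯ → β ∉ K⟮δ, ζ⟯ →
        Nonempty (W.TorsionGal Ω 3 ≃* DihedralGroup 6)) ∧
      (K⟮δ, ζ, s, t⟯ ≠ K⟮δ, ζ⟯ →
        α ∉ K⟮δ, ζ⟯ ∧ Nonempty (W.TorsionGal Ω 3 ≃* Matrix.GeneralLinearGroup (Fin 2) (ZMod 3)))) := by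
  have hζ' : ζ ^ 2 + ζ + 1 = 0 := by
    have h := hζ.isRoot_cyclotomic (by norm_num)
    simpa [Polynomial.cyclotomic_three] using h
  -- If `3` vanished in the residue field, its characteristic `p` would divide `3`.
  have h3 : IsUnit (3 : 𝒪[K]) := by
    rw [← IsLocalRing.residue_ne_zero_iff_isUnit, map_ofNat, ← Nat.cast_ofNat, ne_eq,
      CharP.cast_eq_zero_iff 𝓀[K] p, Nat.dvd_prime Nat.prime_three]
    rintro (h | h)
    · exact CharP.char_ne_one 𝓀[K] p h
    · exact hp h
  subst hα hs ht
  obtain ⟨D⟩ := WeierstrassCurve.exists_threeTorsionData hadd h3 (x := ![α, α₂, α₃, α₄])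
    hroots hδ hδK hδα hζ' hβ
  exact ⟨D.torsionGal_of_mem_mem, D.torsionGal_of_mem_notMem, D.torsionGal_of_notMem_mem,
    D.torsionGal_of_notMem_notMem⟩
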